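/- Let $D=[0,1]\times[0,1]$, $0<\alpha\le 1$, and let $k_1,k_2,k_3,k_4,f$ be real functions continuous on $D$. Let $W=W_2^{(3,2)}(D)$ be the real Hilbert space of functions $y$ on $D$ such that $\partial^3y/\partial\xi^2\partial\eta$ exists and is completely (i.e. absolutely, in the sense of Carathéodory) continuous in $D$, $\partial^5y/\partial\xi^3\partial\eta^2\in L^2(D)$, $y(\xi,0)=y(0,\eta)=y(1,\eta)=0$, and $\partial_\xi^3\partial_\eta y(\cdot,0)$, $\partial_\eta^2\partial_\xi y(0,\cdot)\in L^2[0,1]$, with inner product $$\langle y,v\rangle_W=\sum_{i=0}^{1}\int_0^1\partial_\eta^2\partial_\xi^i y(0,\eta)\,\partial_\eta^2\partial_\xi^i v(0,\eta)\,d\eta+\int_0^1\partial_\eta^2y(1,\eta)\,\partial_\eta^2v(1,\eta)\,d\eta+\sum_{j=0}^{1}\langle\partial_\eta^jy(\cdot,0),\partial_\eta^jv(\cdot,0)\rangle_{3}+\iint_D\partial_\xi^3\partial_\eta^2y\,\partial_\xi^3\partial_\eta^2v\,d\xi\,d\eta ,$$ where $\langle g,h\rangle_{3}=g(0)h(0)+g'(0)h'(0)+g(1)h(1)+\int_0^1g'''h'''$.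 For $(x,t)\in D$ put $K_{(x,t)}(\xi,\eta)=R_x^{\{3\}}(\xi)R_t^{\{2\}}(\eta)$, where $$R_t^{\{2\}}(\eta)=\begin{cases}\eta t+\tfrac12t\eta^2-\tfrac16\eta^3,&\eta\le t,\\-\tfrac16t^3+\tfrac12\eta t^2+t\eta,&\eta>t,\end{cases}$$ and $R_x^{\{3\}}(\xi)=-\tfrac1{120}(x-1)\xi(\xi x^4-4\xi x^3+6\xi x^2+x\xi^4-5x\xi^3-120x\xi+120x+\xi^4)$ for $\xi\le x$, $R_x^{\{3\}}(\xi)=R_\xi^{\{3\}}(x)$ for $\xi>x$. Let $$Ly=D_\eta^\alpha y+k_1y_{\xi\xi}+k_2y+k_3y_\xi ,$$ where $D_\eta^\alpha y(\xi,\eta)=\frac1{\Gamma(1-\alpha)}\int_0^\eta\frac{\partial_ry(\xi,r)}{(\eta-r)^\alpha}dr$ for $\alpha<1$ and $D_\eta^1y=\partial_\eta y$, and assume that $L$ is injective on $W$: if $z\in W$ and $Lz=0$ on $D$, then $z=0$. Let $F(\xi,\eta,u,w)=f(\xi,\eta)-k_4(\xi,\eta)\,u\,w$, and let $y\in W$ be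 a solution of $$Ly(\xi,\eta)=F\big(\xi,\eta,y(\xi,\eta),\partial_\xi y(\xi,\eta)\big),\qquad(\xi,\eta)\in D$$ (the conditions $y(\xi,0)=y(0,\eta)=y(1,\eta)=0$ being part of $y\in W$). Let $(\xi_i,\eta_i)_{i\ge1}$ be a sequence of points of $D$, dense in $D$, and $\psi_i(\xi,\eta)=L_{(x,t)}K_{(x,t)}(\xi,\eta)\big|_{(x,t)=(\xi_i,\eta_i)}$. Let $\overline\psi_i=\sum_{k=1}^i\beta_{ik}\psi_k$, with $\beta_{ii}>0$, be obtained from $(\psi_i)$ by Gram–Schmidt orthonormalization in $W$: the $\overline\psi_i$ are pairwise orthogonal and each has norm $1$, except that $\overline\psi_i=0$ when $\psi_i$ depends linearly on $\psi_1,\dots,\psi_{i-1}$ (then the $\beta_{ik}$ are any coefficients with $\beta_{ii}>0$ giving $0$). Then $K$ is a reproducing kernel of $W$ (that is, $K_{(x,t)}\in W$ and $\langle v,K_{(x,t)}\rangle_W=v(x,t)$ for all $v\in W$, $(x,t)\in D$), all $\overline\psi_i$ belong to $W$, and $$y(\xi,\eta)=\sum_{i=1}^\infty\sum_{k=1}^i\beta_{ik}\,F\big(\xi_k,\eta_k,y(\xi_k,\eta_k),\partial_\xi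 y(\xi_k,\eta_k)\big)\,\overline\psi_i(\xi,\eta),$$ where the series converges to $y$ in the norm of $W$ and uniformly on $D$. -/

import Mathlib

open Set Filter Topology MeasureTheory

noncomputable section

namespace Burgers

/-- The unit interval `[0,1]`. -/
def I : Set ℝ := Icc 0 1

/-- The unit square `D = [0,1] × [0,1]`. -/
def D : Set (ℝ × ℝ) := I ×ˢ I

/-! Functions on `D` are represented by functions `ℝ → ℝ → ℝ`; only their values on `D` matter.
All derivatives are taken within `[0,1]`, hence are one-sided at the end points. -/

/-- Derivative of a function on `[0,1]`. -/
def der (g : ℝ → ℝ) (s : ℝ) : ℝ := derivWithin g I s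

/-- `∂u/∂ξ` (the first variable). -/
def dXi (u : ℝ → ℝ → ℝ) (ξ η : ℝ) : ℝ := der (fun s => u s η) ξ

/-- `∂u/∂η` (the second variable). -/
def dEta (u : ℝ → ℝ → ℝ) (ξ η : ℝ) : ℝ := der (fun r => u ξ r) η

/-- Caputo derivative of order `α ∈ (0,1]`:
`(1/Γ(1-α)) ∫₀^η u'(r) (η-r)^(-α) dr` for `α < 1`, and `u'(η)` for `α = 1`. -/
def caputo (α : ℝ) (u : ℝ → ℝ) (η : ℝ) : ℝ :=
  if α = 1 then der u η
  else 1 / Real.Gamma (1 - α) * ∫ r in (0 : ℝ)..η, der u r / (η - r) ^ α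

/-- `c` is an integrable density on `D` of the rectangle increments of `v`, that is,
`c = ∂²v/∂ξ∂η` for the absolutely continuous function `v`. Such a `c` is unique almost
everywhere in `D`. -/
def IsMixedDensity (v : ℝ → ℝ → ℝ) (c : ℝ × ℝ → ℝ) : Prop :=
  IntegrableOn c D ∧ ∀ ξ ∈ I, ∀ η ∈ I,
    v ξ η - v ξ 0 - v 0 η + v 0 0 = ∫ p in Icc 0 ξ ×ˢ Icc 0 η, c p

/-- Completely (that is, absolutely) continuous functions on `D`, in the sense of Carathéodory:
`v(ξ,η) = v(0,0) + ∫₀^ξ a + ∫₀^η b + ∫₀^ξ∫₀^η c` with integrable `a`, `b`, `c`. -/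
def CompletelyContinuous (v : ℝ → ℝ → ℝ) : Prop :=
  AbsolutelyContinuousOnInterval (fun ξ => v ξ 0) 0 1 ∧
  AbsolutelyContinuousOnInterval (fun η => v 0 η) 0 1 ∧
  ∃ c, IsMixedDensity v c

open Classical in
/-- `∂²v/∂ξ∂η` of a completely continuous `v` (determined almost everywhere in `D`). -/
def mixedDeriv (v : ℝ → ℝ → ℝ) : ℝ × ℝ → ℝ :=
  if h : ∃ c, IsMixedDensity v c then h.choose else 0

/-- `∂³y/∂ξ²∂η`. -/
def d21 (y : ℝ → ℝ → ℝ) : ℝ → ℝ → ℝ := dXi (dXi (dEta y))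

/-- `∂⁵y/∂ξ³∂η² = ∂²/∂ξ∂η (∂³y/∂ξ²∂η)`. -/
def d32 (y : ℝ → ℝ → ℝ) : ℝ × ℝ → ℝ := mixedDeriv (d21 y)

/-- The space `W₂^(3,2)(D)`: `∂³y/∂ξ²∂η` exists and is completely continuous in `D`,
`∂⁵y/∂ξ³∂η² ∈ L²(D)`, and `y(ξ,0) = y(0,η) = y(1,η) = 0`. The one-dimensional derivatives
which the inner product integrates are square integrable as well. -/
structure MemW32 (y : ℝ → ℝ → ℝ) : Prop where
  diff_eta : ∀ ξ ∈ I, DifferentiableOn ℝ (fun η => y ξ η) I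
  diff_xi_eta : ∀ η ∈ I, DifferentiableOn ℝ (fun ξ => dEta y ξ η) I
  diff_xi_xi_eta : ∀ η ∈ I, DifferentiableOn ℝ (fun ξ => dXi (dEta y) ξ η) I
  complCont : CompletelyContinuous (d21 y)
  sq_int : MemLp (d32 y) 2 (volume.restrict D)
  sq_int_bottom : MemLp (fun ξ => dXi (d21 y) ξ 0) 2 (volume.restrict I)
  sq_int_left : MemLp (fun η => dEta (dEta (dXi y)) 0 η) 2 (volume.restrict I)
  bottom : ∀ ξ ∈ I, y ξ 0 = 0
  left : ∀ η ∈ I, y 0 η = 0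
  right : ∀ η ∈ I, y 1 η = 0

/-- The inner product of `W₂³[0,1]`. -/
def inner3 (g h : ℝ → ℝ) : ℝ :=
  g 0 * h 0 + der g 0 * der h 0 + g 1 * h 1
    + ∫ ξ in (0 : ℝ)..1, der (der (der g)) ξ * der (der (der h)) ξ

/-- The inner product of `W₂^(3,2)(D)`. -/
def inner32 (y v : ℝ → ℝ → ℝ) : ℝ :=
  (∫ η in (0 : ℝ)..1, dEta (dEta y) 0 η * dEta (dEta v) 0 η)
  + (∫ η in (0 : ℝ)..1, dEta (dEta (dXi y)) 0 η * dEta (dEta (dXi v)) 0 η)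
  + (∫ η in (0 : ℝ)..1, dEta (dEta y) 1 η * dEta (dEta v) 1 η)
  + inner3 (fun ξ => y ξ 0) (fun ξ => v ξ 0)
  + inner3 (fun ξ => dEta y ξ 0) (fun ξ => dEta v ξ 0)
  + ∫ p in D, d32 y p * d32 v p

/-- The norm of `W₂^(3,2)(D)`. -/
def norm32 (y : ℝ → ℝ → ℝ) : ℝ := Real.sqrt (inner32 y y)

/-- The reproducing kernel `R_t^{2}(η)` of `W₂²[0,1]`. -/
def R2 (t η : ℝ) : ℝ :=
  if η ≤ t then η * t + 1 / 2 * t * η ^ 2 - 1 / 6 * η ^ 3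
  else -(1 / 6) * t ^ 3 + 1 / 2 * η * t ^ 2 + t * η

/-- The reproducing kernel `R_x^{3}(ξ)` of `W₂³[0,1]`. -/
def R3 (x ξ : ℝ) : ℝ :=
  if ξ ≤ x then
    -(1 / 120) * (x - 1) * ξ * (ξ * x ^ 4 - 4 * ξ * x ^ 3 + 6 * ξ * x ^ 2 + x * ξ ^ 4
      - 5 * x * ξ ^ 3 - 120 * x * ξ + 120 * x + ξ ^ 4)
  else
    -(1 / 120) * (ξ - 1) * x * (x * ξ ^ 4 - 4 * x * ξ ^ 3 + 6 * x * ξ ^ 2 + ξ * x ^ 4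
      - 5 * ξ * x ^ 3 - 120 * ξ * x + 120 * ξ + x ^ 4)

/-- The kernel `K_{(x,t)}(ξ,η) = R_x^{3}(ξ) R_t^{2}(η)`. -/
def K (x t ξ η : ℝ) : ℝ := R3 x ξ * R2 t η

/-- `S x t` (a function of `(ξ,η)`, for each `(x,t) ∈ D`) is a reproducing kernel of
`W₂^(3,2)(D)`. -/
def IsReproducingKernel (S : ℝ → ℝ → ℝ → ℝ → ℝ) : Prop :=
  ∀ x ∈ I, ∀ t ∈ I, MemW32 (S x t) ∧ ∀ y, MemW32 y → inner32 y (S x t) = y x t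

/-- The linear operator `L y = D_η^α y + k₁ y_ξξ + k₂ y + k₃ y_ξ`. -/
def L (α : ℝ) (k₁ k₂ k₃ : ℝ → ℝ → ℝ) (y : ℝ → ℝ → ℝ) (ξ η : ℝ) : ℝ :=
  caputo α (fun r => y ξ r) η + k₁ ξ η * dXi (dXi y) ξ η + k₂ ξ η * y ξ η
    + k₃ ξ η * dXi y ξ η

/-- `F(ξ,η,u,w) = f(ξ,η) - k₄(ξ,η) u w`. -/
def F (f k₄ : ℝ → ℝ → ℝ) (ξ η u w : ℝ) : ℝ := f ξ η - k₄ ξ η * u * w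

/-- `ψ(ξ,η) = L_{(x,t)} K_{(x,t)}(ξ,η)` evaluated at `(x,t) = q`. -/
def psi (α : ℝ) (k₁ k₂ k₃ : ℝ → ℝ → ℝ) (q : ℝ × ℝ) (ξ η : ℝ) : ℝ :=
  L α k₁ k₂ k₃ (fun x t => K x t ξ η) q.1 q.2

/-- `ψbar` is obtained from `ψ` by Gram–Schmidt orthonormalization in `W₂^(3,2)(D)`, with
coefficients `β`: `ψbar i = ∑_{k ≤ i} β i k ψ k`, `β i i > 0`, and the `ψbar i` are orthonormal;
where `ψ i` is linearly dependent on its predecessors (and only there), `ψbar i` vanishes. -/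
structure IsGramSchmidt (ψ ψbar : ℕ → ℝ → ℝ → ℝ) (β : ℕ → ℕ → ℝ) : Prop where
  pos : ∀ i, 0 < β i i
  comb : ∀ i ξ η, ψbar i ξ η = ∑ k ∈ Finset.range (i + 1), β i k * ψ k ξ η
  orth : ∀ i j, i ≠ j → inner32 (ψbar i) (ψbar j) = 0
  normal : ∀ i, norm32 (ψbar i) = 1 ∨ ∀ ξ ∈ I, ∀ η ∈ I, ψbar i ξ η = 0

/-- `y` solves `L y = F(ξ,η,y,y_ξ)` on `D` in `W₂^(3,2)(D)`; the conditions
`y(ξ,0) = y(0,η) = y(1,η) = 0` are part of the membership. -/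
def IsSolution (α : ℝ) (k₁ k₂ k₃ k₄ f : ℝ → ℝ → ℝ) (y : ℝ → ℝ → ℝ) : Prop :=
  MemW32 y ∧ ∀ ξ ∈ I, ∀ η ∈ I, L α k₁ k₂ k₃ y ξ η = F f k₄ ξ η (y ξ η) (dXi y ξ η)

/-- `A i = ∑_{k ≤ i} β i k F(ξ_k, η_k, y(ξ_k,η_k), y_ξ(ξ_k,η_k))` with `(ξ_k,η_k) = q k`. -/
def coeff (f k₄ : ℝ → ℝ → ℝ) (q : ℕ → ℝ × ℝ) (β : ℕ → ℕ → ℝ) (y : ℝ → ℝ → ℝ) (i : ℕ) : ℝ :=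
  ∑ k ∈ Finset.range (i + 1),
    β i k * F f k₄ (q k).1 (q k).2 (y (q k).1 (q k).2) (dXi y (q k).1 (q k).2)

end Burgers

end

noncomputable section

namespace Burgers

/-! A function in the space is determined by four pieces of derivative data: `∂ξ³∂η²y` on the
square, `∂ξ³∂ηy` on the bottom edge, `∂η²∂ξy` on the left edge and `∂ξ∂ηy` at the corner. The
vanishing conditions on three sides kill all other terms of the inner product. With a unit atom at 0
added to Lebesgue measure on `[0,1]`, the product measure `atomSq` has exactly these four strata, so
the space becomes `L²(atomSq)`.

The inverse map `synth` integrates the data against `phi3 x r * phi2 t s`. At the atom, `phi3` is `x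
- x²`, which vanishes at 0 and 1 with slope 1 at 0; elsewhere it is the Taylor kernel `(x-r)₊²/2`,
corrected by a multiple of `x²` so as to vanish at 1. `IsSynth.memW32`, `IsSynth.inner32_eq` and
`MemW32.exists_isSynth` make `synth` an isometric bijection, up to equality on `D`; completeness and
the Riesz theorem are then those of `L²`.

Evaluation of `synth h` at a point is the inner product of `h` with `kernelData`, and integrating
products of the one-dimensional kernels gives `R2` and `R3`; hence `K` is reproducing. The
functional `z ↦ L z q` is bounded too, and `psi` is its representer (`exists_isSynth_psi`). A `z`
orthogonal to all these representers has `L z = 0` at a dense set of points, hence on `D` by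
`continuousOn_L`, hence `z = 0` by injectivity. So the orthonormalized system is total and the
Fourier series of the solution converges. Its coefficients are combinations of the values of `L y`
at the points, which the equation turns into values of `F`; the nonlinearity is harmless, being
evaluated along the given solution. Uniform convergence follows because point evaluations are
uniformly bounded on `D`. -/

/-! ### The measure with atoms and its four strata. -/

/-- Lebesgue measure on `[0,1]` with an additional unit atom at `0`, which carries the
initial value of a derivative. -/
def atomMeasure : Measure ℝ := volume.restrict I + Measure.dirac 0

/-- The product of `atomMeasure` with itself. -/
def atomSq : Measure (ℝ × ℝ) := atomMeasure.prod atomMeasure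

lemma measurableSet_I : MeasurableSet I := measurableSet_Icc

lemma measurableSet_D : MeasurableSet D := measurableSet_I.prod measurableSet_I

lemma zero_mem_I : (0 : ℝ) ∈ I := ⟨le_rfl, zero_le_one⟩

lemma one_mem_I : (1 : ℝ) ∈ I := ⟨zero_le_one, le_rfl⟩

lemma uniqueDiffOn_I : UniqueDiffOn ℝ I := uniqueDiffOn_Icc zero_lt_one

instance : IsFiniteMeasure (volume.restrict I) :=
  ⟨by simp [I]⟩

lemma restrict_D : (volume.restrict D : Measure (ℝ × ℝ))
    = (volume.restrict I).prod (volume.restrict I) := by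
  rw [Measure.prod_restrict]; rfl

instance : IsFiniteMeasure (volume.restrict D) := by
  rw [restrict_D]; infer_instance

instance : IsFiniteMeasure atomMeasure := by
  unfold atomMeasure; infer_instance

instance : IsFiniteMeasure atomSq := by
  unfold atomSq; infer_instance

lemma ae_atomMeasure_iff {P : ℝ → Prop} :
    (∀ᵐ r ∂atomMeasure, P r) ↔ (∀ᵐ r ∂(volume.restrict I), P r) ∧ P 0 := by
  rw [atomMeasure, ae_add_measure_iff, ae_dirac_eq]
  simp

lemma ae_mem_I : ∀ᵐ r ∂atomMeasure, r ∈ I :=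
  ae_atomMeasure_iff.2 ⟨ae_restrict_mem measurableSet_I, zero_mem_I⟩

lemma ae_atomSq_fst {P : ℝ → Prop} (h : ∀ᵐ r ∂atomMeasure, P r) : ∀ᵐ p ∂atomSq, P p.1 :=
  Measure.quasiMeasurePreserving_fst.ae h

lemma ae_atomSq_snd {P : ℝ → Prop} (h : ∀ᵐ r ∂atomMeasure, P r) : ∀ᵐ p ∂atomSq, P p.2 :=
  Measure.quasiMeasurePreserving_snd.ae h

/-- Expanding the product of two sums gives the square, the bottom edge, the left edge and the
corner, one stratum for each kind of derivative data. -/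
lemma atomSq_eq : atomSq = volume.restrict D + (volume.restrict I).map (fun r => (r, (0 : ℝ)))
    + ((volume.restrict I).map (fun s => ((0 : ℝ), s)) + Measure.dirac (0, 0)) := by
  have e : (Measure.dirac (0 : ℝ)).map (Prod.mk (0 : ℝ)) = Measure.dirac (0, 0) :=
    Measure.map_dirac' measurable_prodMk_left 0
  rw [atomSq, atomMeasure, Measure.prod_add, Measure.add_prod, Measure.add_prod, restrict_D,
    Measure.prod_dirac, Measure.dirac_prod, Measure.dirac_prod, e]
  rw [add_add_add_comm]

lemma measurableEmbedding_bottom : MeasurableEmbedding (fun r : ℝ => (r, (0 : ℝ))) :=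
  MeasurableEmbedding.of_measurable_inverse (g := Prod.fst) (by fun_prop)
    (by
      have : range (fun r : ℝ => (r, (0 : ℝ))) = univ ×ˢ {0} := by
        ext ⟨a, b⟩; simp [eq_comm]
      rw [this]; exact MeasurableSet.univ.prod (measurableSet_singleton 0))
    (by fun_prop) (fun _ => rfl)

lemma measurableEmbedding_left : MeasurableEmbedding (fun s : ℝ => ((0 : ℝ), s)) :=
  MeasurableEmbedding.of_measurable_inverse (g := Prod.snd) (by fun_prop)
    (by
      have : range (fun s : ℝ => ((0 : ℝ), s)) = {0} ×ˢ univ := by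
        ext ⟨a, b⟩; simp [eq_comm]
      rw [this]; exact (measurableSet_singleton 0).prod MeasurableSet.univ)
    (by fun_prop) (fun _ => rfl)

lemma integrable_atomSq_iff {f : ℝ × ℝ → ℝ} :
    Integrable f atomSq ↔ IntegrableOn f D ∧ IntegrableOn (fun r => f (r, 0)) I ∧
      IntegrableOn (fun s => f (0, s)) I := by
  rw [atomSq_eq, integrable_add_measure, integrable_add_measure, integrable_add_measure,
    measurableEmbedding_bottom.integrable_map_iff, measurableEmbedding_left.integrable_map_iff]
  have : Integrable f (Measure.dirac ((0 : ℝ), (0 : ℝ))) := integrable_dirac (by simp)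
  simp only [this, and_true, and_assoc]
  rfl

lemma integral_atomSq {f : ℝ × ℝ → ℝ} (hf : Integrable f atomSq) :
    ∫ p, f p ∂atomSq = (∫ p in D, f p) + (∫ r in I, f (r, 0)) + (∫ s in I, f (0, s)) + f (0, 0) := by
  have h := hf
  rw [atomSq_eq] at h ⊢
  rw [integral_add_measure h.left_of_add_measure h.right_of_add_measure,
    integral_add_measure h.left_of_add_measure.left_of_add_measure
      h.left_of_add_measure.right_of_add_measure,
    integral_add_measure h.right_of_add_measure.left_of_add_measure
      h.right_of_add_measure.right_of_add_measure,
    measurableEmbedding_bottom.integral_map, measurableEmbedding_left.integral_map, integral_dirac]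
  ring

lemma aestronglyMeasurable_atomSq_iff {f : ℝ × ℝ → ℝ} :
    AEStronglyMeasurable f atomSq ↔ AEStronglyMeasurable f (volume.restrict D) ∧
      AEStronglyMeasurable (fun r => f (r, 0)) (volume.restrict I) ∧
      AEStronglyMeasurable (fun s => f (0, s)) (volume.restrict I) := by
  rw [atomSq_eq, aestronglyMeasurable_add_measure_iff, aestronglyMeasurable_add_measure_iff,
    aestronglyMeasurable_add_measure_iff, measurableEmbedding_bottom.aestronglyMeasurable_map_iff,
    measurableEmbedding_left.aestronglyMeasurable_map_iff]
  have : AEStronglyMeasurable f (Measure.dirac ((0 : ℝ), (0 : ℝ))) := aestronglyMeasurable_dirac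
  simp only [this, and_true, and_assoc]
  rfl

lemma memLp_atomSq_iff {f : ℝ × ℝ → ℝ} :
    MemLp f 2 atomSq ↔ MemLp f 2 (volume.restrict D) ∧
      MemLp (fun r => f (r, 0)) 2 (volume.restrict I) ∧
      MemLp (fun s => f (0, s)) 2 (volume.restrict I) := by
  constructor
  · intro h
    have hm := aestronglyMeasurable_atomSq_iff.1 h.1
    have hi := integrable_atomSq_iff.1 ((memLp_two_iff_integrable_sq h.1).1 h)
    exact ⟨(memLp_two_iff_integrable_sq hm.1).2 hi.1, (memLp_two_iff_integrable_sq hm.2.1).2 hi.2.1,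
      (memLp_two_iff_integrable_sq hm.2.2).2 hi.2.2⟩
  · rintro ⟨h1, h2, h3⟩
    have hm := aestronglyMeasurable_atomSq_iff.2 ⟨h1.1, h2.1, h3.1⟩
    refine (memLp_two_iff_integrable_sq hm).2 (integrable_atomSq_iff.2 ⟨?_, ?_, ?_⟩)
    · exact (memLp_two_iff_integrable_sq h1.1).1 h1
    · exact (memLp_two_iff_integrable_sq h2.1).1 h2
    · exact (memLp_two_iff_integrable_sq h3.1).1 h3

lemma ae_D_ne_zero : ∀ᵐ p ∂(volume.restrict D : Measure (ℝ × ℝ)), p.1 ≠ 0 ∧ p.2 ≠ 0 := by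
  have h : ∀ᵐ r ∂(volume.restrict I : Measure ℝ), r ≠ 0 :=
    ae_restrict_of_ae (Measure.ae_ne volume 0)
  rw [restrict_D]
  exact (Measure.quasiMeasurePreserving_fst.ae h).and (Measure.quasiMeasurePreserving_snd.ae h)

lemma ae_I_ne_zero : ∀ᵐ r ∂(volume.restrict I : Measure ℝ), r ≠ 0 :=
  ae_restrict_of_ae (Measure.ae_ne volume 0)

/-- The function with prescribed restrictions to the strata of `atomSq`. -/
def glue (p₀ : ℝ) (g a : ℝ → ℝ) (c : ℝ × ℝ → ℝ) (p : ℝ × ℝ) : ℝ :=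
  if p.1 = 0 then (if p.2 = 0 then p₀ else g p.2) else (if p.2 = 0 then a p.1 else c p)

/-- The two edges are null for area measure, so the values prescribed there are invisible on the
square. -/
lemma glue_ae_D (p₀ : ℝ) (g a : ℝ → ℝ) (c : ℝ × ℝ → ℝ) :
    glue p₀ g a c =ᵐ[volume.restrict D] c := by
  filter_upwards [ae_D_ne_zero] with p hp
  simp [glue, hp.1, hp.2]

lemma glue_ae_bottom (p₀ : ℝ) (g a : ℝ → ℝ) (c : ℝ × ℝ → ℝ) :
    (fun r => glue p₀ g a c (r, 0)) =ᵐ[volume.restrict I] a := by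
  filter_upwards [ae_I_ne_zero] with p hp
  simp [glue, hp]

lemma glue_ae_left (p₀ : ℝ) (g a : ℝ → ℝ) (c : ℝ × ℝ → ℝ) :
    (fun s => glue p₀ g a c (0, s)) =ᵐ[volume.restrict I] g := by
  filter_upwards [ae_I_ne_zero] with p hp
  simp [glue, hp]

lemma glue_zero (p₀ : ℝ) (g a : ℝ → ℝ) (c : ℝ × ℝ → ℝ) : glue p₀ g a c (0, 0) = p₀ := by
  simp [glue]

lemma memLp_glue (p₀ : ℝ) {g a : ℝ → ℝ} {c : ℝ × ℝ → ℝ} (hg : MemLp g 2 (volume.restrict I))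
    (ha : MemLp a 2 (volume.restrict I)) (hc : MemLp c 2 (volume.restrict D)) :
    MemLp (glue p₀ g a c) 2 atomSq :=
  memLp_atomSq_iff.2 ⟨(memLp_congr_ae (glue_ae_D p₀ g a c)).2 hc,
    (memLp_congr_ae (glue_ae_bottom p₀ g a c)).2 ha,
    (memLp_congr_ae (glue_ae_left p₀ g a c)).2 hg⟩

/-! ### Integral transforms with product kernels. -/

/-- Differentiation under the integral sign within `[0,1]`. -/
lemma hasDerivWithinAt_integral_of_lip {Ω : Type*} [MeasurableSpace Ω] {μ : Measure Ω}
    {Φ : ℝ → Ω → ℝ} {Φ' g : Ω → ℝ} {x : ℝ} (hx : x ∈ I)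
    (hint : ∀ x ∈ I, Integrable (Φ x) μ) (hg : Integrable g μ)
    (hlip : ∀ᵐ ω ∂μ, ∀ x' ∈ I, |Φ x' ω - Φ x ω| ≤ g ω * |x' - x|)
    (hder : ∀ᵐ ω ∂μ, HasDerivWithinAt (fun x => Φ x ω) (Φ' ω) I x) :
    HasDerivWithinAt (fun x => ∫ ω, Φ x ω ∂μ) (∫ ω, Φ' ω ∂μ) I x := by
  rw [hasDerivWithinAt_iff_tendsto_slope]
  have key : ∀ x' ∈ I, slope (fun x => ∫ ω, Φ x ω ∂μ) x x'
      = ∫ ω, slope (fun x => Φ x ω) x x' ∂μ := by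
    intro x' hx'
    simp only [slope_def_field]
    rw [← integral_sub (hint x' hx') (hint x hx), integral_div]
  have hmem : ∀ᶠ x' in 𝓝[I \ {x}] x, x' ∈ I \ {x} := self_mem_nhdsWithin
  refine Tendsto.congr' (f₁ := fun x' => ∫ ω, slope (fun x => Φ x ω) x x' ∂μ) ?_ ?_
  · filter_upwards [hmem] with x' hx'
    exact (key x' hx'.1).symm
  · refine tendsto_integral_filter_of_dominated_convergence g ?_ ?_ hg ?_
    · filter_upwards [hmem] with x' hx'
      simp only [slope_def_field]
      exact (((hint x' hx'.1).sub (hint x hx)).div_const _).aestronglyMeasurable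
    · filter_upwards [hmem] with x' hx'
      filter_upwards [hlip] with ω hω
      have h0 : 0 < |x' - x| := abs_pos.2 (sub_ne_zero.2 hx'.2)
      rw [slope_def_field, Real.norm_eq_abs, abs_div, div_le_iff₀ h0]
      exact hω x' hx'.1
    · filter_upwards [hder] with ω hω
      exact hasDerivWithinAt_iff_tendsto_slope.1 hω

/-- Bounded kernels which are almost everywhere continuous in the parameter. -/
structure IsKernel (A : ℝ → ℝ → ℝ) : Prop where
  meas : ∀ x, Measurable (A x)
  bdd : ∃ C, ∀ x ∈ I, ∀ r ∈ I, |A x r| ≤ C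
  cont : ∀ x ∈ I, ∀ᵐ r ∂atomMeasure, ContinuousWithinAt (fun x => A x r) I x

/-- `A'` is the derivative of the kernel `A` with respect to the parameter. -/
structure HasKernelDeriv (A A' : ℝ → ℝ → ℝ) : Prop where
  lip : ∃ C, ∀ r ∈ I, ∀ x ∈ I, ∀ x' ∈ I, |A x' r - A x r| ≤ C * |x' - x|
  deriv : ∀ x ∈ I, ∀ᵐ r ∂atomMeasure, HasDerivWithinAt (fun x => A x r) (A' x r) I x

/-- The integral transform of `h` by the product of the kernels `A` and `B`. -/
def kInt (A B : ℝ → ℝ → ℝ) (h : ℝ × ℝ → ℝ) (x t : ℝ) : ℝ :=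
  ∫ p, A x p.1 * B t p.2 * h p ∂atomSq

section kInt

variable {A A' B B' : ℝ → ℝ → ℝ} {h : ℝ × ℝ → ℝ} {x t : ℝ}

lemma IsKernel.nonneg_bdd (hA : IsKernel A) :
    ∃ C, 0 ≤ C ∧ ∀ x ∈ I, ∀ r ∈ I, |A x r| ≤ C := by
  obtain ⟨C, hC⟩ := hA.bdd
  exact ⟨C, (abs_nonneg _).trans (hC 0 zero_mem_I 0 zero_mem_I), hC⟩

lemma IsKernel.mul_bdd (hA : IsKernel A) (hB : IsKernel B) :
    ∃ C, 0 ≤ C ∧ ∀ x ∈ I, ∀ t ∈ I, ∀ᵐ p ∂atomSq, |A x p.1 * B t p.2| ≤ C := by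
  obtain ⟨C, hC0, hC⟩ := hA.nonneg_bdd
  obtain ⟨C', hC0', hC'⟩ := hB.nonneg_bdd
  refine ⟨C * C', mul_nonneg hC0 hC0', fun x hx t ht => ?_⟩
  filter_upwards [ae_atomSq_fst ae_mem_I, ae_atomSq_snd ae_mem_I] with p h1 h2
  rw [abs_mul]
  exact mul_le_mul (hC x hx _ h1) (hC' t ht _ h2) (abs_nonneg _) hC0

lemma IsKernel.aestronglyMeasurable_mul (hA : IsKernel A) (hB : IsKernel B) :
    AEStronglyMeasurable (fun p : ℝ × ℝ => A x p.1 * B t p.2) atomSq :=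
  (((hA.meas x).comp measurable_fst).mul ((hB.meas t).comp measurable_snd)).aestronglyMeasurable

lemma IsKernel.integrable (hA : IsKernel A) (hB : IsKernel B) (hh : Integrable h atomSq)
    (hx : x ∈ I) (ht : t ∈ I) : Integrable (fun p => A x p.1 * B t p.2 * h p) atomSq := by
  obtain ⟨C, -, hC⟩ := hA.mul_bdd hB
  exact hh.bdd_mul (hA.aestronglyMeasurable_mul hB) (hC x hx t ht)

lemma IsKernel.memLp (hA : IsKernel A) (hB : IsKernel B)
    (hx : x ∈ I) (ht : t ∈ I) : MemLp (fun p => A x p.1 * B t p.2) 2 atomSq := by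
  obtain ⟨C, -, hC⟩ := hA.mul_bdd hB
  exact MemLp.of_bound (hA.aestronglyMeasurable_mul hB) C (hC x hx t ht)

lemma hasDerivWithinAt_kInt_fst (hA : IsKernel A) (hA' : HasKernelDeriv A A') (hB : IsKernel B)
    (hh : Integrable h atomSq) (hx : x ∈ I) (ht : t ∈ I) :
    HasDerivWithinAt (fun x => kInt A B h x t) (kInt A' B h x t) I x := by
  obtain ⟨C, hC⟩ := hA'.lip
  obtain ⟨C', hC0', hC'⟩ := hB.nonneg_bdd
  refine hasDerivWithinAt_integral_of_lip (g := fun p => C * C' * |h p|) hx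
    (fun x hx => hA.integrable hB hh hx ht) (hh.abs.const_mul _) ?_ ?_
  · filter_upwards [ae_atomSq_fst ae_mem_I, ae_atomSq_snd ae_mem_I] with p h1 h2 x' hx'
    have e : A x' p.1 * B t p.2 * h p - A x p.1 * B t p.2 * h p
        = (A x' p.1 - A x p.1) * B t p.2 * h p := by ring
    rw [e, abs_mul, abs_mul]
    have := mul_le_mul (hC _ h1 x hx x' hx') (hC' t ht _ h2) (abs_nonneg _)
      ((abs_nonneg _).trans (hC _ h1 x hx x' hx'))
    calc _ ≤ C * |x' - x| * C' * |h p| := mul_le_mul_of_nonneg_right this (abs_nonneg _)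
      _ = _ := by ring
  · filter_upwards [ae_atomSq_fst (hA'.deriv x hx)] with p hp
    exact (hp.mul_const _).mul_const _

lemma hasDerivWithinAt_kInt_snd (hA : IsKernel A) (hB : IsKernel B) (hB' : HasKernelDeriv B B')
    (hh : Integrable h atomSq) (hx : x ∈ I) (ht : t ∈ I) :
    HasDerivWithinAt (fun t => kInt A B h x t) (kInt A B' h x t) I t := by
  obtain ⟨C, hC⟩ := hB'.lip
  obtain ⟨C', hC0', hC'⟩ := hA.nonneg_bdd
  refine hasDerivWithinAt_integral_of_lip (g := fun p => C' * C * |h p|) ht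
    (fun t ht => hA.integrable hB hh hx ht) (hh.abs.const_mul _) ?_ ?_
  · filter_upwards [ae_atomSq_fst ae_mem_I, ae_atomSq_snd ae_mem_I] with p h1 h2 t' ht'
    have e : A x p.1 * B t' p.2 * h p - A x p.1 * B t p.2 * h p
        = A x p.1 * (B t' p.2 - B t p.2) * h p := by ring
    rw [e, abs_mul, abs_mul]
    have := mul_le_mul (hC' x hx _ h1) (hC _ h2 t ht t' ht') (abs_nonneg _) hC0'
    calc _ ≤ C' * (C * |t' - t|) * |h p| := mul_le_mul_of_nonneg_right this (abs_nonneg _)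
      _ = _ := by ring
  · filter_upwards [ae_atomSq_snd (hB'.deriv t ht)] with p hp
    exact (hp.const_mul _).mul_const _

/-- Dominated convergence: kernels continuous in the parameter only for almost every `r` suffice, so
step kernels are admitted. -/
lemma continuousOn_kInt (hA : IsKernel A) (hB : IsKernel B) (hh : Integrable h atomSq) :
    ContinuousOn (fun q : ℝ × ℝ => kInt A B h q.1 q.2) D := by
  obtain ⟨C, -, hC⟩ := hA.mul_bdd hB
  intro q hq
  have hmem : ∀ᶠ q' in 𝓝[D] q, q' ∈ D := self_mem_nhdsWithin
  refine tendsto_integral_filter_of_dominated_convergence (fun p => C * |h p|) ?_ ?_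
    (hh.abs.const_mul _) ?_
  · filter_upwards [hmem] with q' hq'
    exact (hA.integrable hB hh hq'.1 hq'.2).aestronglyMeasurable
  · filter_upwards [hmem] with q' hq'
    filter_upwards [hC _ hq'.1 _ hq'.2] with p hp
    rw [Real.norm_eq_abs, abs_mul]
    exact mul_le_mul_of_nonneg_right hp (abs_nonneg _)
  · filter_upwards [ae_atomSq_fst (hA.cont _ hq.1), ae_atomSq_snd (hB.cont _ hq.2)] with p h1 h2
    have t1 : Tendsto (fun q' : ℝ × ℝ => q'.1) (𝓝[D] q) (𝓝[I] q.1) :=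
      tendsto_nhdsWithin_iff.2 ⟨continuous_fst.continuousAt.tendsto.mono_left nhdsWithin_le_nhds,
        hmem.mono fun _ h => h.1⟩
    have t2 : Tendsto (fun q' : ℝ × ℝ => q'.2) (𝓝[D] q) (𝓝[I] q.2) :=
      tendsto_nhdsWithin_iff.2 ⟨continuous_snd.continuousAt.tendsto.mono_left nhdsWithin_le_nhds,
        hmem.mono fun _ h => h.2⟩
    exact ((h1.tendsto.comp t1).mul (h2.tendsto.comp t2)).mul_const _

lemma kInt_congr_ae {k : ℝ × ℝ → ℝ} (e : h =ᵐ[atomSq] k) : kInt A B h x t = kInt A B k x t := by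
  refine integral_congr_ae ?_
  filter_upwards [e] with p hp
  rw [hp]

lemma kInt_add {k : ℝ × ℝ → ℝ} (hA : IsKernel A) (hB : IsKernel B) (hh : Integrable h atomSq)
    (hk : Integrable k atomSq) (hx : x ∈ I) (ht : t ∈ I) :
    kInt A B (fun p => h p + k p) x t = kInt A B h x t + kInt A B k x t := by
  simp only [kInt, mul_add]
  exact integral_add (hA.integrable hB hh hx ht) (hA.integrable hB hk hx ht)

lemma kInt_smul (c : ℝ) : kInt A B (fun p => c * h p) x t = c * kInt A B h x t := by
  simp only [kInt, mul_left_comm _ c]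
  exact integral_const_mul _ _

/-- Functions on `D` given by an integral transform are differentiable in the first variable. -/
lemma hasDerivWithinAt_fst_of_eqOn {u : ℝ → ℝ → ℝ} (hu : ∀ x ∈ I, ∀ t ∈ I, u x t = kInt A B h x t)
    (hA : IsKernel A) (hA' : HasKernelDeriv A A') (hB : IsKernel B)
    (hh : Integrable h atomSq) (hx : x ∈ I) (ht : t ∈ I) :
    HasDerivWithinAt (fun x => u x t) (kInt A' B h x t) I x :=
  (hasDerivWithinAt_kInt_fst hA hA' hB hh hx ht).congr (fun x hx => hu x hx t ht) (hu x hx t ht)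

lemma hasDerivWithinAt_snd_of_eqOn {u : ℝ → ℝ → ℝ} (hu : ∀ x ∈ I, ∀ t ∈ I, u x t = kInt A B h x t)
    (hA : IsKernel A) (hB : IsKernel B) (hB' : HasKernelDeriv B B')
    (hh : Integrable h atomSq) (hx : x ∈ I) (ht : t ∈ I) :
    HasDerivWithinAt (fun t => u x t) (kInt A B' h x t) I t :=
  (hasDerivWithinAt_kInt_snd hA hB hB' hh hx ht).congr (fun t ht => hu x hx t ht) (hu x hx t ht)

lemma dXi_eq_of_eqOn {u : ℝ → ℝ → ℝ} (hu : ∀ x ∈ I, ∀ t ∈ I, u x t = kInt A B h x t)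
    (hA : IsKernel A) (hA' : HasKernelDeriv A A') (hB : IsKernel B) (hh : Integrable h atomSq) :
    ∀ x ∈ I, ∀ t ∈ I, dXi u x t = kInt A' B h x t := fun x hx _ ht =>
  (hasDerivWithinAt_fst_of_eqOn hu hA hA' hB hh hx ht).derivWithin (uniqueDiffOn_I x hx)

lemma dEta_eq_of_eqOn {u : ℝ → ℝ → ℝ} (hu : ∀ x ∈ I, ∀ t ∈ I, u x t = kInt A B h x t)
    (hA : IsKernel A) (hB : IsKernel B) (hB' : HasKernelDeriv B B') (hh : Integrable h atomSq) :
    ∀ x ∈ I, ∀ t ∈ I, dEta u x t = kInt A B' h x t := fun _ hx t ht =>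
  (hasDerivWithinAt_snd_of_eqOn hu hA hB hB' hh hx ht).derivWithin (uniqueDiffOn_I t ht)

end kInt

/-! ### The one-dimensional kernels. -/

/-- The positive part `(t - s)₊`. -/
def phi2 (t s : ℝ) : ℝ := max (t - s) 0

/-- Derivative of `phi2` in the first variable. -/
def dphi2 (t s : ℝ) : ℝ := if s ≤ t then 1 else 0

/-- Kernel recovering `g` with `g 0 = g 1 = 0` from `g' 0` (at the atom) and `g'''`. -/
def phi3 (x r : ℝ) : ℝ :=
  if r = 0 then x - x ^ 2 else max (x - r) 0 ^ 2 / 2 - x ^ 2 * (1 - r) ^ 2 / 2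

/-- Derivative of `phi3` in the first variable. -/
def dphi3 (x r : ℝ) : ℝ :=
  if r = 0 then 1 - 2 * x else max (x - r) 0 - x * (1 - r) ^ 2

/-- Second derivative of `phi3` in the first variable. -/
def ddphi3 (x r : ℝ) : ℝ :=
  if r = 0 then -2 else (if r ≤ x then 1 else 0) - (1 - r) ^ 2

/-- The kernels are irregular only at `r = x`. This point is null unless it is the atom 0, and at `r
= 0` the ramp is linear and the step constant on `[0,1]`, so that case does no harm. -/
lemma ae_generic (x : ℝ) : ∀ᵐ r ∂atomMeasure, r ∈ I ∧ (r ≠ x ∨ r = 0) :=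
  ae_mem_I.and (ae_atomMeasure_iff.2
    ⟨(ae_restrict_of_ae (Measure.ae_ne volume x)).mono fun _ h => Or.inl h, Or.inr rfl⟩)

lemma hasDerivWithinAt_ramp {x r : ℝ} (hx : x ∈ I) (h : r ∈ I ∧ (r ≠ x ∨ r = 0)) :
    HasDerivWithinAt (fun x => max (x - r) 0) (if r ≤ x then 1 else 0) I x := by
  have hid : HasDerivWithinAt (fun x : ℝ => x - r) 1 I x :=
    (hasDerivWithinAt_id x I).sub_const r
  by_cases h0 : r = 0
  · subst h0
    rw [if_pos hx.1]
    exact hid.congr (fun y hy => max_eq_left (by simpa using hy.1)) (max_eq_left (by simpa using hx.1))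
  rcases lt_or_gt_of_ne (h.2.resolve_right h0) with hlt | hlt
  · rw [if_pos hlt.le]
    refine hid.congr_of_eventuallyEq ?_ (max_eq_left (by linarith))
    filter_upwards [nhdsWithin_le_nhds (lt_mem_nhds hlt)] with y hy
    exact max_eq_left (by linarith)
  · rw [if_neg (not_le.2 hlt)]
    refine (hasDerivWithinAt_const x I (0 : ℝ)).congr_of_eventuallyEq ?_ (max_eq_right (by linarith))
    filter_upwards [nhdsWithin_le_nhds (gt_mem_nhds hlt)] with y hy
    exact max_eq_right (by linarith)

lemma continuousWithinAt_step {x r : ℝ} (hx : x ∈ I) (h : r ∈ I ∧ (r ≠ x ∨ r = 0)) :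
    ContinuousWithinAt (fun x => if r ≤ x then (1 : ℝ) else 0) I x := by
  by_cases h0 : r = 0
  · subst h0
    exact (continuousWithinAt_const (b := (1 : ℝ))).congr (fun y hy => if_pos hy.1) (if_pos hx.1)
  rcases lt_or_gt_of_ne (h.2.resolve_right h0) with hlt | hlt
  · refine (continuousWithinAt_const (b := (1 : ℝ))).congr_of_eventuallyEq ?_ (if_pos hlt.le)
    filter_upwards [nhdsWithin_le_nhds (lt_mem_nhds hlt)] with y hy
    exact if_pos hy.le
  · refine (continuousWithinAt_const (b := (0 : ℝ))).congr_of_eventuallyEq ?_ (if_neg (not_le.2 hlt))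
    filter_upwards [nhdsWithin_le_nhds (gt_mem_nhds hlt)] with y hy
    exact if_neg (not_le.2 hy)

lemma ramp_mem {x r : ℝ} (hx : x ∈ I) (hr : r ∈ I) : 0 ≤ max (x - r) 0 ∧ max (x - r) 0 ≤ 1 :=
  ⟨le_max_right _ _, max_le (by linarith [hx.2, hr.1]) zero_le_one⟩

lemma abs_ramp_sub_le (x x' r : ℝ) : |max (x' - r) 0 - max (x - r) 0| ≤ |x' - x| := by
  have := abs_max_sub_max_le_abs (x' - r) (x - r) 0
  simpa using this

lemma hasKernelDeriv_phi2 : HasKernelDeriv phi2 dphi2 where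
  lip := ⟨1, fun r _ x _ x' _ => by simpa [phi2] using abs_ramp_sub_le x x' r⟩
  deriv x hx := (ae_generic x).mono fun _ h => hasDerivWithinAt_ramp hx h

lemma hasKernelDeriv_phi3 : HasKernelDeriv phi3 dphi3 where
  lip := by
    refine ⟨4, fun r hr x hx x' hx' => ?_⟩
    have h1 := ramp_mem hx hr
    have h2 := ramp_mem hx' hr
    have hd := abs_ramp_sub_le x x' r
    have hr2 : 0 ≤ (1 - r) ^ 2 ∧ (1 - r) ^ 2 ≤ 1 :=
      ⟨sq_nonneg _, by nlinarith [hr.1, hr.2]⟩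
    have hs : |x' + x| ≤ 2 := abs_le.2 ⟨by linarith [hx.1, hx'.1], by linarith [hx.2, hx'.2]⟩
    unfold phi3
    split_ifs with h0
    · rw [show x' - x' ^ 2 - (x - x ^ 2) = (1 - (x' + x)) * (x' - x) by ring, abs_mul]
      refine mul_le_mul_of_nonneg_right ?_ (abs_nonneg _)
      exact abs_le.2 ⟨by linarith [hx.2, hx'.2], by linarith [hx.1, hx'.1]⟩
    · generalize max (x - r) 0 = u at *
      generalize max (x' - r) 0 = u' at *
      rw [show u' ^ 2 / 2 - x' ^ 2 * (1 - r) ^ 2 / 2 - (u ^ 2 / 2 - x ^ 2 * (1 - r) ^ 2 / 2)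
        = (u' + u) / 2 * (u' - u) - ((1 - r) ^ 2 * (x' + x) / 2) * (x' - x) by ring]
      refine (abs_sub _ _).trans ?_
      rw [abs_mul, abs_mul]
      have a1 : |(u' + u) / 2| ≤ 1 := abs_le.2 ⟨by linarith, by linarith⟩
      have a2 : |(1 - r) ^ 2 * (x' + x) / 2| ≤ 1 := by
        rw [abs_le]
        constructor <;> nlinarith [hx.1, hx'.1, hx.2, hx'.2]
      have b1 := mul_le_mul a1 hd (abs_nonneg _) zero_le_one
      have b2 := mul_le_mul_of_nonneg_right a2 (abs_nonneg (x' - x))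
      linarith [abs_nonneg (x' - x)]
  deriv x hx := by
    filter_upwards [ae_generic x] with r hr
    have h := hasDerivWithinAt_ramp hx hr
    have hid := hasDerivWithinAt_id x I
    by_cases h0 : r = 0
    · simp only [phi3, dphi3, if_pos h0]
      have := hid.sub (hid.pow 2)
      refine this.congr_deriv ?_
      simp
    · simp only [phi3, dphi3, if_neg h0]
      have := ((h.pow 2).div_const 2).sub (((hid.pow 2).mul_const ((1 - r) ^ 2)).div_const 2)
      refine this.congr_deriv ?_
      split_ifs with hle
      · simp; ring
      · rw [max_eq_right (by linarith)]; simp; ring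

lemma hasKernelDeriv_dphi3 : HasKernelDeriv dphi3 ddphi3 where
  lip := by
    refine ⟨2, fun r hr x hx x' hx' => ?_⟩
    have hd := abs_ramp_sub_le x x' r
    have hr2 : |(1 - r) ^ 2| ≤ 1 := abs_le.2 ⟨by nlinarith, by nlinarith [hr.1, hr.2]⟩
    unfold dphi3
    split_ifs with h0
    · rw [show 1 - 2 * x' - (1 - 2 * x) = (-2) * (x' - x) by ring, abs_mul]
      norm_num
    · generalize max (x - r) 0 = u at *
      generalize max (x' - r) 0 = u' at *
      rw [show u' - x' * (1 - r) ^ 2 - (u - x * (1 - r) ^ 2)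
        = (u' - u) - (1 - r) ^ 2 * (x' - x) by ring]
      refine (abs_sub _ _).trans ?_
      rw [abs_mul]
      have b2 := mul_le_mul_of_nonneg_right hr2 (abs_nonneg (x' - x))
      linarith
  deriv x hx := by
    filter_upwards [ae_generic x] with r hr
    have h := hasDerivWithinAt_ramp hx hr
    have hid := hasDerivWithinAt_id x I
    by_cases h0 : r = 0
    · simp only [dphi3, ddphi3, if_pos h0]
      have := (hid.const_mul 2).const_sub 1
      simpa using this
    · simp only [dphi3, ddphi3, if_neg h0]
      have := h.sub (hid.mul_const ((1 - r) ^ 2))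
      refine this.congr_deriv ?_
      simp

lemma HasKernelDeriv.cont {A A' : ℝ → ℝ → ℝ} (h : HasKernelDeriv A A') {x : ℝ} (hx : x ∈ I) :
    ∀ᵐ r ∂atomMeasure, ContinuousWithinAt (fun x => A x r) I x :=
  (h.deriv x hx).mono fun _ h => h.continuousWithinAt

lemma isKernel_phi2 : IsKernel phi2 where
  meas x := by unfold phi2; fun_prop
  bdd := ⟨1, fun x hx r hr => by
    have := ramp_mem hx hr
    exact abs_le.2 ⟨by unfold phi2; linarith, this.2⟩⟩
  cont _ hx := hasKernelDeriv_phi2.cont hx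

lemma measurable_step (x : ℝ) : Measurable (fun r : ℝ => if r ≤ x then (1 : ℝ) else 0) :=
  Measurable.ite measurableSet_Iic measurable_const measurable_const

lemma isKernel_dphi2 : IsKernel dphi2 where
  meas x := measurable_step x
  bdd := ⟨1, fun x hx r hr => by unfold dphi2; split_ifs <;> simp⟩
  cont x hx := (ae_generic x).mono fun _ h => continuousWithinAt_step hx h

lemma isKernel_phi3 : IsKernel phi3 where
  meas x := Measurable.ite (measurableSet_singleton 0) measurable_const (by fun_prop)
  bdd := by
    refine ⟨1, fun x hx r hr => ?_⟩
    have h1 := ramp_mem hx hr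
    have hr2 : 0 ≤ (1 - r) ^ 2 ∧ (1 - r) ^ 2 ≤ 1 :=
      ⟨sq_nonneg _, by nlinarith [hr.1, hr.2]⟩
    have hx2 : 0 ≤ x ^ 2 ∧ x ^ 2 ≤ 1 := ⟨sq_nonneg _, by nlinarith [hx.1, hx.2]⟩
    unfold phi3
    split_ifs with h0
    · exact abs_le.2 ⟨by linarith [hx.1], by linarith [hx.2]⟩
    · generalize max (x - r) 0 = u at *
      have := mul_nonneg hx2.1 hr2.1
      have : x ^ 2 * (1 - r) ^ 2 ≤ 1 := by nlinarith
      exact abs_le.2 ⟨by nlinarith, by nlinarith⟩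
  cont _ hx := hasKernelDeriv_phi3.cont hx

lemma isKernel_dphi3 : IsKernel dphi3 where
  meas x := Measurable.ite (measurableSet_singleton 0) measurable_const (by fun_prop)
  bdd := by
    refine ⟨1, fun x hx r hr => ?_⟩
    have h1 := ramp_mem hx hr
    have hr2 : 0 ≤ (1 - r) ^ 2 ∧ (1 - r) ^ 2 ≤ 1 :=
      ⟨sq_nonneg _, by nlinarith [hr.1, hr.2]⟩
    unfold dphi3
    split_ifs with h0
    · exact abs_le.2 ⟨by linarith [hx.2], by linarith [hx.1]⟩
    · have := mul_nonneg hx.1 hr2.1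
      have : x * (1 - r) ^ 2 ≤ 1 := by nlinarith [hx.1, hx.2]
      exact abs_le.2 ⟨by linarith, by linarith⟩
  cont _ hx := hasKernelDeriv_dphi3.cont hx

lemma isKernel_ddphi3 : IsKernel ddphi3 where
  meas x := Measurable.ite (measurableSet_singleton 0) measurable_const
    ((measurable_step x).sub (by fun_prop))
  bdd := by
    refine ⟨2, fun x hx r hr => ?_⟩
    have hr2 : 0 ≤ (1 - r) ^ 2 ∧ (1 - r) ^ 2 ≤ 1 :=
      ⟨sq_nonneg _, by nlinarith [hr.1, hr.2]⟩
    unfold ddphi3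
    split_ifs with h0
    · norm_num
    · exact abs_le.2 ⟨by linarith, by linarith⟩
    · exact abs_le.2 ⟨by linarith, by linarith⟩
  cont x hx := by
    filter_upwards [ae_generic x] with r hr
    by_cases h0 : r = 0
    · simp only [ddphi3, if_pos h0]; exact continuousWithinAt_const
    · simp only [ddphi3, if_neg h0]
      exact (continuousWithinAt_step hx hr).sub continuousWithinAt_const

/-- The synthesis operator: the function on `D` with prescribed derivative data `h`. -/
def synth (h : ℝ × ℝ → ℝ) : ℝ → ℝ → ℝ := kInt phi3 phi2 h

/-! ### Absolute continuity and mixed densities. -/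

lemma intervalIntegral_eq_Icc {f : ℝ → ℝ} {x : ℝ} (hx : 0 ≤ x) :
    ∫ r in (0 : ℝ)..x, f r = ∫ r in Icc 0 x, f r := by
  rw [intervalIntegral.integral_of_le hx, integral_Icc_eq_integral_Ioc]

lemma intervalIntegrable_of_integrableOn_I {a : ℝ → ℝ} (ha : IntegrableOn a I) :
    IntervalIntegrable a volume 0 1 := by
  rw [intervalIntegrable_iff, uIoc_of_le zero_le_one]
  exact ha.mono_set Ioc_subset_Icc_self

lemma der_ae_of_eq_integral {u a : ℝ → ℝ} {c : ℝ} (ha : IntegrableOn a I)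
    (hu : ∀ x ∈ I, u x = c + ∫ r in (0 : ℝ)..x, a r) :
    ∀ᵐ x ∂(volume.restrict I), der u x = a x := by
  rw [ae_restrict_iff' measurableSet_I]
  filter_upwards [(intervalIntegrable_of_integrableOn_I ha).ae_hasDerivAt_integral] with x h hx
  rw [uIcc_of_le zero_le_one] at h
  have h1 := (h hx 0 zero_mem_I).hasDerivWithinAt (s := I)
  exact ((h1.const_add c).congr hu (hu x hx)).derivWithin (uniqueDiffOn_I x hx)

lemma absolutelyContinuousOnInterval_congr {u v : ℝ → ℝ} (h : ∀ x ∈ I, u x = v x)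
    (hv : AbsolutelyContinuousOnInterval v 0 1) : AbsolutelyContinuousOnInterval u 0 1 := by
  rw [absolutelyContinuousOnInterval_iff] at hv ⊢
  intro ε hε
  obtain ⟨δ, hδ, H⟩ := hv ε hε
  refine ⟨δ, hδ, fun E hE hs => ?_⟩
  have := H E hE hs
  rw [Finset.sum_congr rfl (fun i hi => ?_)]
  · exact this
  · have hm := hE.1 i hi
    rw [uIcc_of_le zero_le_one] at hm
    rw [h _ hm.1, h _ hm.2]

lemma absolutelyContinuousOnInterval_of_eq_integral {u a : ℝ → ℝ} {c : ℝ} (ha : IntegrableOn a I)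
    (hu : ∀ x ∈ I, u x = c + ∫ r in (0 : ℝ)..x, a r) :
    AbsolutelyContinuousOnInterval u 0 1 := by
  have h1 := (intervalIntegrable_of_integrableOn_I
    ha).absolutelyContinuousOnInterval_intervalIntegral (c := 0) (by simp)
  have h2 : AbsolutelyContinuousOnInterval (fun _ : ℝ => c) 0 1 := by
    have : LipschitzOnWith 0 (fun _ : ℝ => c) (uIcc 0 1) := LipschitzWith.const c |>.lipschitzOnWith
    exact this.absolutelyContinuousOnInterval
  exact absolutelyContinuousOnInterval_congr hu (h2.add h1)

/-- The fundamental theorem of calculus in terms of `der`. -/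
lemma eq_integral_der_of_absolutelyContinuous {u : ℝ → ℝ}
    (hu : AbsolutelyContinuousOnInterval u 0 1) :
    IntegrableOn (der u) I ∧ ∀ x ∈ I, u x = u 0 + ∫ r in (0 : ℝ)..x, der u r := by
  have hae : ∀ r ∈ Ioo (0 : ℝ) 1, der u r = deriv u r := fun r hr =>
    derivWithin_of_mem_nhds (Icc_mem_nhds hr.1 hr.2)
  have hi := hu.intervalIntegrable_deriv
  rw [intervalIntegrable_iff, uIoc_of_le zero_le_one] at hi
  refine ⟨?_, fun x hx => ?_⟩
  · rw [I, integrableOn_Icc_iff_integrableOn_Ioo]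
    exact (hi.mono_set Ioo_subset_Ioc_self).congr_fun (fun r hr => (hae r hr).symm)
      measurableSet_Ioo
  · have h1 : AbsolutelyContinuousOnInterval u 0 x := hu.mono (by
      rw [uIcc_of_le hx.1, uIcc_of_le zero_le_one]; exact Icc_subset_Icc_right hx.2)
    have h2 := h1.integral_deriv_eq_sub
    have h3 : ∫ r in (0 : ℝ)..x, der u r = ∫ r in (0 : ℝ)..x, deriv u r := by
      rw [intervalIntegral.integral_of_le hx.1, intervalIntegral.integral_of_le hx.1,
        integral_Ioc_eq_integral_Ioo, integral_Ioc_eq_integral_Ioo]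
      exact setIntegral_congr_fun measurableSet_Ioo
        fun r hr => hae r ⟨hr.1, hr.2.trans_le hx.2⟩
    rw [h3, h2]; ring

/-- Integrable functions on `D` with the same integrals over the rectangles `[0,ξ] × [0,η]`
agree almost everywhere. -/
lemma ae_eq_zero_of_rect {f : ℝ × ℝ → ℝ} (hf : IntegrableOn f D)
    (h : ∀ ξ ∈ I, ∀ η ∈ I, ∫ p in Icc 0 ξ ×ˢ Icc 0 η, f p = 0) :
    f =ᵐ[volume.restrict D] 0 := by
  have hall : ∫ p in D, f p = 0 := h 1 one_mem_I 1 one_mem_I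
  have hspan : IsCountablySpanning (range (Iic : ℝ → Set ℝ)) :=
    ⟨fun n => Iic (n : ℝ), fun n => ⟨n, rfl⟩, by
      refine eq_univ_of_forall fun x => mem_iUnion.2 ?_
      exact (exists_nat_ge x)⟩
  refine Integrable.ae_eq_zero_of_forall_setIntegral_eq_zero hf fun s hs _ => ?_
  -- The quadrants `Iic a ×ˢ Iic b` form a π-system generating the product σ-algebra, and each meets
  -- `D` in a rectangle with corner at the origin or not at all.
  refine MeasurableSpace.induction_on_inter (C := fun s _ => ∫ p in s, f p ∂(volume.restrict D) = 0)
    (generateFrom_eq_prod (borel_eq_generateFrom_Iic ℝ).symm (borel_eq_generateFrom_Iic ℝ).symm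
      hspan hspan).symm (isPiSystem_Iic.prod isPiSystem_Iic) (by simp) ?_ ?_ ?_ s hs
  · rintro _ ⟨_, ⟨a, rfl⟩, _, ⟨b, rfl⟩, rfl⟩
    have hm : MeasurableSet (Iic a ×ˢ Iic b) := measurableSet_Iic.prod measurableSet_Iic
    rw [Measure.restrict_restrict hm]
    by_cases hab : 0 ≤ a ∧ 0 ≤ b
    · rw [← h (min a 1) ⟨le_min hab.1 zero_le_one, min_le_right _ _⟩ (min b 1)
        ⟨le_min hab.2 zero_le_one, min_le_right _ _⟩]
      congr 2
      ext ⟨x, y⟩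
      simp only [D, I, mem_inter_iff, mem_prod, mem_Iic, mem_Icc, le_min_iff]
      tauto
    · have : (Iic a ×ˢ Iic b) ∩ D = ∅ := by
        ext ⟨x, y⟩
        simp only [D, I, mem_inter_iff, mem_prod, mem_Iic, mem_Icc, mem_empty_iff_false, iff_false]
        rintro ⟨⟨h1, h2⟩, ⟨h3, -⟩, h5, -⟩
        exact hab ⟨h3.trans h1, h5.trans h2⟩
      rw [this]; simp
  · intro t ht h0
    rw [setIntegral_compl ht hf, h0, hall, sub_zero]
  · intro g hd hg h0
    rw [integral_iUnion hg hd hf.integrableOn]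
    simp [h0]

lemma IsMixedDensity.ae_unique {v : ℝ → ℝ → ℝ} {c c' : ℝ × ℝ → ℝ} (h : IsMixedDensity v c)
    (h' : IsMixedDensity v c') : c =ᵐ[volume.restrict D] c' := by
  have := ae_eq_zero_of_rect (f := fun p => c p - c' p) (h.1.sub h'.1) fun ξ hξ η hη => by
    have hs : Icc 0 ξ ×ˢ Icc 0 η ⊆ D :=
      prod_mono (Icc_subset_Icc_right hξ.2) (Icc_subset_Icc_right hη.2)
    rw [integral_sub (h.1.mono_set hs) (h'.1.mono_set hs), ← h.2 ξ hξ η hη, ← h'.2 ξ hξ η hη,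
      sub_self]
  filter_upwards [this] with p hp
  exact sub_eq_zero.1 hp

lemma isMixedDensity_mixedDeriv {v : ℝ → ℝ → ℝ} (h : ∃ c, IsMixedDensity v c) :
    IsMixedDensity v (mixedDeriv v) := by
  rw [mixedDeriv, dif_pos h]; exact h.choose_spec

/-- `mixedDeriv` is an arbitrary choice; almost everywhere uniqueness lets any explicit density
replace it. -/
lemma IsMixedDensity.mixedDeriv_ae {v : ℝ → ℝ → ℝ} {c : ℝ × ℝ → ℝ} (h : IsMixedDensity v c) :
    mixedDeriv v =ᵐ[volume.restrict D] c :=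
  (isMixedDensity_mixedDeriv ⟨c, h⟩).ae_unique h

/-! ### Recovering the data from derivatives of the transform. -/

section

variable {h : ℝ × ℝ → ℝ}

/-- Fubini with `s` outermost: `dphi2 t` cuts off at `s ≤ t`, and the atom at `s = 0` contributes
the initial value. The transform is thus an explicit primitive in `t`. -/
lemma kInt_dphi2 {A : ℝ → ℝ → ℝ} (hA : IsKernel A) (hh : Integrable h atomSq) {x t : ℝ}
    (hx : x ∈ I) (ht : t ∈ I) :
    kInt A dphi2 h x t = (∫ r, A x r * h (r, 0) ∂atomMeasure)
      + ∫ s in (0 : ℝ)..t, ∫ r, A x r * h (r, s) ∂atomMeasure := by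
  have h1 := hA.integrable isKernel_dphi2 hh hx ht
  have e : ∀ s, ∫ r, A x r * dphi2 t s * h (r, s) ∂atomMeasure
      = (Iic t).indicator (fun s => ∫ r, A x r * h (r, s) ∂atomMeasure) s := by
    intro s
    by_cases hs : s ≤ t
    · simp [dphi2, hs]
    · simp [dphi2, hs]
  have h2 : kInt A dphi2 h x t = ∫ s, ∫ r, A x r * dphi2 t s * h (r, s) ∂atomMeasure ∂atomMeasure :=
    integral_prod_symm _ h1
  have h3 := h1.integral_prod_right
  simp only [e] at h2 h3
  rw [h2]
  rw [atomMeasure] at h3 ⊢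
  rw [integral_add_measure h3.left_of_add_measure h3.right_of_add_measure, integral_dirac,
    indicator_of_mem (show (0 : ℝ) ∈ Iic t from ht.1), add_comm, intervalIntegral_eq_Icc ht.1,
    setIntegral_indicator measurableSet_Iic]
  congr 3
  ext s
  simp only [I, mem_inter_iff, mem_Icc, mem_Iic]
  exact ⟨fun h => ⟨h.1.1, h.2⟩, fun h => ⟨⟨h.1, h.2.trans ht.2⟩, h.2⟩⟩

lemma integrableOn_kInt_density {A : ℝ → ℝ → ℝ} (hA : IsKernel A) (hh : Integrable h atomSq) {x : ℝ}
    (hx : x ∈ I) : IntegrableOn (fun s => ∫ r, A x r * h (r, s) ∂atomMeasure) I := by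
  -- At `t = 1` the cut-off is identically 1 on `[0,1]`.
  have h1 := hA.integrable isKernel_dphi2 hh hx one_mem_I
  have h2 := h1.integral_prod_right
  have h3 : Integrable (fun s => ∫ r, A x r * dphi2 1 s * h (r, s) ∂atomMeasure)
    (volume.restrict I) := (by
      rw [atomMeasure] at h2 ⊢
      exact h2.left_of_add_measure)
  refine IntegrableOn.congr_fun h3 (fun s hs => ?_) measurableSet_I
  have : s ≤ 1 := hs.2
  simp [dphi2, this]

lemma integral_atomMeasure_of_eq_zero {f : ℝ → ℝ} (hf : ∀ r ∈ I, r ≠ 0 → f r = 0) :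
    ∫ r, f r ∂atomMeasure = f 0 := by
  have : f =ᵐ[atomMeasure] (fun r => ({0} : Set ℝ).indicator (fun _ => f 0) r) := by
    filter_upwards [ae_mem_I] with r hr
    by_cases h0 : r = 0
    · simp [h0]
    · simp [h0, hf r hr h0]
  rw [integral_congr_ae this, integral_indicator (measurableSet_singleton 0), setIntegral_const]
  simp [atomMeasure, measureReal_def]

/-- At the left edge `dphi3` vanishes away from the atom, where it equals 1; the `ξ`-derivative
there sees only the data on `{0} × [0,1]`. -/
lemma integral_dphi3_zero (s : ℝ) : ∫ r, dphi3 0 r * h (r, s) ∂atomMeasure = h (0, s) := by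
  rw [integral_atomMeasure_of_eq_zero fun r hr h0 => ?_]
  · simp [dphi3]
  · have : max (-r) 0 = 0 := max_eq_right (by linarith [hr.1])
    simp [dphi3, h0, this]

lemma kInt_dphi3_zero (hh : Integrable h atomSq) {t : ℝ} (ht : t ∈ I) :
    kInt dphi3 dphi2 h 0 t = h (0, 0) + ∫ s in (0 : ℝ)..t, h (0, s) := by
  rw [kInt_dphi2 isKernel_dphi3 hh zero_mem_I ht]
  simp only [integral_dphi3_zero]

/-- Passing from 0 to `x` changes `ddphi3` by the indicator of `r ≤ x` off the atom and by nothing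
at the atom. The left edge and the corner drop out, leaving the bottom edge and the square. -/
lemma kInt_ddphi3_sub (hh : Integrable h atomSq) {x t : ℝ} (hx : x ∈ I) (ht : t ∈ I) :
    kInt ddphi3 dphi2 h x t - kInt ddphi3 dphi2 h 0 t
      = (∫ r in (0 : ℝ)..x, h (r, 0)) + ∫ p in Icc 0 x ×ˢ Icc 0 t, h p := by
  have i1 := isKernel_ddphi3.integrable isKernel_dphi2 hh hx ht
  have i2 := isKernel_ddphi3.integrable isKernel_dphi2 hh zero_mem_I ht
  rw [kInt, kInt, ← integral_sub i1 i2, integral_atomSq (f := fun p => ddphi3 x p.1 * dphi2 t p.2 * h p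
    - ddphi3 0 p.1 * dphi2 t p.2 * h p) (i1.sub i2)]
  have e0 : ∀ s, ddphi3 x 0 * dphi2 t s * h (0, s) - ddphi3 0 0 * dphi2 t s * h (0, s) = 0 := by
    intro s; simp [ddphi3]
  simp only [e0, integral_zero, add_zero]
  have eb : ∀ r ∈ I, r ≠ 0 → ddphi3 x r - ddphi3 0 r = (Icc 0 x).indicator 1 r := by
    intro r hr h0
    have : ¬ r ≤ 0 := not_le.2 (lt_of_le_of_ne hr.1 (Ne.symm h0))
    by_cases hrx : r ≤ x
    · simp [ddphi3, h0, this, hrx, indicator_of_mem (show r ∈ Icc 0 x from ⟨hr.1, hrx⟩)]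
    · simp [ddphi3, h0, this, hrx]
  rw [add_comm]
  congr 1
  · rw [intervalIntegral_eq_Icc hx.1]
    have : (fun r => ddphi3 x r * dphi2 t 0 * h (r, 0) - ddphi3 0 r * dphi2 t 0 * h (r, 0))
        =ᵐ[volume.restrict I] (Icc 0 x).indicator (fun r => h (r, 0)) := by
      filter_upwards [ae_I_ne_zero, ae_restrict_mem measurableSet_I] with r h0 hr
      have h1 : dphi2 t 0 = 1 := if_pos ht.1
      rw [h1, mul_one, mul_one, ← sub_mul, eb r hr h0]
      by_cases hm : r ∈ Icc 0 x <;> simp [hm]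
    rw [integral_congr_ae this, setIntegral_indicator measurableSet_Icc,
      inter_eq_self_of_subset_right (show Icc 0 x ⊆ I from Icc_subset_Icc_right hx.2)]
  · have : (fun p : ℝ × ℝ => ddphi3 x p.1 * dphi2 t p.2 * h p - ddphi3 0 p.1 * dphi2 t p.2 * h p)
        =ᵐ[volume.restrict D] (Icc 0 x ×ˢ Icc 0 t).indicator h := by
      filter_upwards [ae_D_ne_zero, ae_restrict_mem measurableSet_D] with p h0 hp
      rw [← sub_mul, ← sub_mul, eb p.1 hp.1 h0.1]
      by_cases hm : p.1 ∈ Icc 0 x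
      · by_cases hm2 : p.2 ≤ t
        · rw [indicator_of_mem (show p ∈ Icc 0 x ×ˢ Icc 0 t from ⟨hm, hp.2.1, hm2⟩)]
          simp [hm, dphi2, hm2]
        · rw [indicator_of_notMem (show p ∉ Icc 0 x ×ˢ Icc 0 t from fun h => hm2 h.2.2)]
          simp [dphi2, hm2]
      · rw [indicator_of_notMem (show p ∉ Icc 0 x ×ˢ Icc 0 t from fun h => hm h.1)]
        simp [hm]
    rw [integral_congr_ae this, setIntegral_indicator (measurableSet_Icc.prod measurableSet_Icc),
      inter_eq_self_of_subset_right]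
    exact prod_mono (Icc_subset_Icc_right hx.2) (Icc_subset_Icc_right ht.2)

lemma kInt_ddphi3_bottom (hh : Integrable h atomSq) {x : ℝ} (hx : x ∈ I) :
    kInt ddphi3 dphi2 h x 0 = kInt ddphi3 dphi2 h 0 0 + ∫ r in (0 : ℝ)..x, h (r, 0) := by
  have h1 := kInt_ddphi3_sub hh hx zero_mem_I
  have h2 : (volume : Measure (ℝ × ℝ)) (Icc 0 x ×ˢ Icc (0 : ℝ) 0) = 0 := by
    rw [Measure.volume_eq_prod, Measure.prod_prod]; simp
  rw [setIntegral_measure_zero _ h2] at h1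
  linarith

lemma phi3_zero_left {r : ℝ} (hr : r ∈ I) : phi3 0 r = 0 := by
  have : max (-r) 0 = 0 := max_eq_right (by linarith [hr.1])
  simp [phi3, this]

lemma phi3_one_left {r : ℝ} (hr : r ∈ I) : phi3 1 r = 0 := by
  have : max (1 - r) 0 = 1 - r := max_eq_left (by linarith [hr.2])
  simp [phi3, this]

lemma phi2_zero_left {s : ℝ} (hs : s ∈ I) : phi2 0 s = 0 := by
  have : max (-s) 0 = 0 := max_eq_right (by linarith [hs.1])
  simp [phi2, this]

lemma kInt_eq_zero_of_fst {A B : ℝ → ℝ → ℝ} {x t : ℝ} (hA : ∀ r ∈ I, A x r = 0) :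
    kInt A B h x t = 0 := by
  refine integral_eq_zero_of_ae ?_
  filter_upwards [ae_atomSq_fst ae_mem_I] with p hp
  simp [hA _ hp]

lemma kInt_eq_zero_of_snd {A B : ℝ → ℝ → ℝ} {x t : ℝ} (hB : ∀ r ∈ I, B t r = 0) :
    kInt A B h x t = 0 := by
  refine integral_eq_zero_of_ae ?_
  filter_upwards [ae_atomSq_snd ae_mem_I] with p hp
  simp [hB _ hp]

end

/-! ### Synthesized functions lie in the space, isometrically. -/

/-- `y` is, on `D`, the function with derivative data `h`. -/
structure IsSynth (h : ℝ × ℝ → ℝ) (y : ℝ → ℝ → ℝ) : Prop where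
  memLp : MemLp h 2 atomSq
  eq : ∀ ξ ∈ I, ∀ η ∈ I, y ξ η = synth h ξ η

namespace IsSynth

variable {h k : ℝ × ℝ → ℝ} {y v : ℝ → ℝ → ℝ}

lemma integrable (H : IsSynth h y) : Integrable h atomSq := H.memLp.integrable (by norm_num)

lemma dEta_eq (H : IsSynth h y) : ∀ ξ ∈ I, ∀ η ∈ I, dEta y ξ η = kInt phi3 dphi2 h ξ η :=
  dEta_eq_of_eqOn H.eq isKernel_phi3 isKernel_phi2 hasKernelDeriv_phi2 H.integrable

lemma dXi_eq (H : IsSynth h y) : ∀ ξ ∈ I, ∀ η ∈ I, dXi y ξ η = kInt dphi3 phi2 h ξ η :=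
  dXi_eq_of_eqOn H.eq isKernel_phi3 hasKernelDeriv_phi3 isKernel_phi2 H.integrable

lemma dXi_dXi_eq (H : IsSynth h y) :
    ∀ ξ ∈ I, ∀ η ∈ I, dXi (dXi y) ξ η = kInt ddphi3 phi2 h ξ η :=
  dXi_eq_of_eqOn H.dXi_eq isKernel_dphi3 hasKernelDeriv_dphi3 isKernel_phi2 H.integrable

lemma dXi_dEta_eq (H : IsSynth h y) :
    ∀ ξ ∈ I, ∀ η ∈ I, dXi (dEta y) ξ η = kInt dphi3 dphi2 h ξ η :=
  dXi_eq_of_eqOn H.dEta_eq isKernel_phi3 hasKernelDeriv_phi3 isKernel_dphi2 H.integrable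

lemma dEta_dXi_eq (H : IsSynth h y) :
    ∀ ξ ∈ I, ∀ η ∈ I, dEta (dXi y) ξ η = kInt dphi3 dphi2 h ξ η :=
  dEta_eq_of_eqOn H.dXi_eq isKernel_dphi3 isKernel_phi2 hasKernelDeriv_phi2 H.integrable

lemma d21_eq (H : IsSynth h y) : ∀ ξ ∈ I, ∀ η ∈ I, d21 y ξ η = kInt ddphi3 dphi2 h ξ η :=
  dXi_eq_of_eqOn H.dXi_dEta_eq isKernel_dphi3 hasKernelDeriv_dphi3 isKernel_dphi2 H.integrable

/-- In the rectangle increment the two bottom-edge integrals cancel, leaving the integral of the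
data over the rectangle. -/
lemma isMixedDensity (H : IsSynth h y) : IsMixedDensity (d21 y) h := by
  refine ⟨(integrable_atomSq_iff.1 H.integrable).1, fun ξ hξ η hη => ?_⟩
  rw [H.d21_eq ξ hξ η hη, H.d21_eq ξ hξ 0 zero_mem_I, H.d21_eq 0 zero_mem_I η hη,
    H.d21_eq 0 zero_mem_I 0 zero_mem_I, kInt_ddphi3_bottom H.integrable hξ]
  linarith [kInt_ddphi3_sub H.integrable hξ hη]

lemma d32_ae (H : IsSynth h y) : d32 y =ᵐ[volume.restrict D] h := H.isMixedDensity.mixedDeriv_ae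

lemma d21_bottom (H : IsSynth h y) :
    ∀ ξ ∈ I, d21 y ξ 0 = kInt ddphi3 dphi2 h 0 0 + ∫ r in (0 : ℝ)..ξ, h (r, 0) := fun ξ hξ => by
  rw [H.d21_eq ξ hξ 0 zero_mem_I, kInt_ddphi3_bottom H.integrable hξ]

lemma dXi_d21_ae (H : IsSynth h y) :
    (fun ξ => dXi (d21 y) ξ 0) =ᵐ[volume.restrict I] fun ξ => h (ξ, 0) :=
  der_ae_of_eq_integral (integrable_atomSq_iff.1 H.integrable).2.1 H.d21_bottom

lemma dEta_dEta_dXi_ae (H : IsSynth h y) :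
    (fun η => dEta (dEta (dXi y)) 0 η) =ᵐ[volume.restrict I] fun η => h (0, η) :=
  der_ae_of_eq_integral (integrable_atomSq_iff.1 H.integrable).2.2 fun η hη => by
    rw [H.dEta_dXi_eq 0 zero_mem_I η hη, kInt_dphi3_zero H.integrable hη]

lemma memW32 (H : IsSynth h y) : MemW32 y where
  diff_eta ξ hξ η hη := (hasDerivWithinAt_snd_of_eqOn H.eq isKernel_phi3 isKernel_phi2
    hasKernelDeriv_phi2 H.integrable hξ hη).differentiableWithinAt
  diff_xi_eta η hη ξ hξ := (hasDerivWithinAt_fst_of_eqOn H.dEta_eq isKernel_phi3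
    hasKernelDeriv_phi3 isKernel_dphi2 H.integrable hξ hη).differentiableWithinAt
  diff_xi_xi_eta η hη ξ hξ := (hasDerivWithinAt_fst_of_eqOn H.dXi_dEta_eq isKernel_dphi3
    hasKernelDeriv_dphi3 isKernel_dphi2 H.integrable hξ hη).differentiableWithinAt
  complCont := by
    refine ⟨absolutelyContinuousOnInterval_of_eq_integral
      (integrable_atomSq_iff.1 H.integrable).2.1 H.d21_bottom,
      absolutelyContinuousOnInterval_of_eq_integral
        (c := ∫ r, ddphi3 0 r * h (r, 0) ∂atomMeasure) (integrableOn_kInt_density isKernel_ddphi3 H.integrable zero_mem_I) fun η hη => ?_,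
      _, H.isMixedDensity⟩
    rw [H.d21_eq 0 zero_mem_I η hη, kInt_dphi2 isKernel_ddphi3 H.integrable zero_mem_I hη]
  sq_int := (memLp_congr_ae H.d32_ae).2 (memLp_atomSq_iff.1 H.memLp).1
  sq_int_bottom := (memLp_congr_ae H.dXi_d21_ae).2 (memLp_atomSq_iff.1 H.memLp).2.1
  sq_int_left := (memLp_congr_ae H.dEta_dEta_dXi_ae).2 (memLp_atomSq_iff.1 H.memLp).2.2
  bottom ξ hξ := by rw [H.eq ξ hξ 0 zero_mem_I]; exact kInt_eq_zero_of_snd fun _ => phi2_zero_left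
  left η hη := by rw [H.eq 0 zero_mem_I η hη]; exact kInt_eq_zero_of_fst fun _ => phi3_zero_left
  right η hη := by rw [H.eq 1 one_mem_I η hη]; exact kInt_eq_zero_of_fst fun _ => phi3_one_left

end IsSynth

lemma der_eq_zero_of_eqOn {u : ℝ → ℝ} (hu : ∀ x ∈ I, u x = 0) : ∀ x ∈ I, der u x = 0 := by
  intro x hx
  rw [der, derivWithin_congr (f := fun _ => (0 : ℝ)) hu (hu x hx)]
  simp

/-- The inner product of functions vanishing on three sides of `D`. -/
lemma MemW32.inner32_eq {y v : ℝ → ℝ → ℝ} (hy : MemW32 y) :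
    inner32 y v = (∫ η in I, dEta (dEta (dXi y)) 0 η * dEta (dEta (dXi v)) 0 η)
      + dXi (dEta y) 0 0 * dXi (dEta v) 0 0
      + (∫ ξ in I, dXi (d21 y) ξ 0 * dXi (d21 v) ξ 0)
      + ∫ p in D, d32 y p * d32 v p := by
  have l1 : ∀ η ∈ I, dEta y 0 η = 0 := der_eq_zero_of_eqOn hy.left
  have r1 : ∀ η ∈ I, dEta y 1 η = 0 := der_eq_zero_of_eqOn hy.right
  have l2 : ∀ η ∈ I, dEta (dEta y) 0 η = 0 := der_eq_zero_of_eqOn l1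
  have r2 : ∀ η ∈ I, dEta (dEta y) 1 η = 0 := der_eq_zero_of_eqOn r1
  have t1 : ∫ η in (0 : ℝ)..1, dEta (dEta y) 0 η * dEta (dEta v) 0 η = 0 := by
    rw [intervalIntegral_eq_Icc zero_le_one]
    exact setIntegral_eq_zero_of_forall_eq_zero fun η hη => by rw [l2 η hη, zero_mul]
  have t3 : ∫ η in (0 : ℝ)..1, dEta (dEta y) 1 η * dEta (dEta v) 1 η = 0 := by
    rw [intervalIntegral_eq_Icc zero_le_one]
    exact setIntegral_eq_zero_of_forall_eq_zero fun η hη => by rw [r2 η hη, zero_mul]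
  have b1 := der_eq_zero_of_eqOn hy.bottom
  have b3 := der_eq_zero_of_eqOn (der_eq_zero_of_eqOn b1)
  have t4 : inner3 (fun ξ => y ξ 0) (fun ξ => v ξ 0) = 0 := by
    rw [inner3, hy.bottom 0 zero_mem_I, hy.bottom 1 one_mem_I, b1 0 zero_mem_I,
      intervalIntegral_eq_Icc zero_le_one, setIntegral_eq_zero_of_forall_eq_zero
        fun ξ hξ => by rw [b3 ξ hξ, zero_mul]]
    ring
  have t5 : inner3 (fun ξ => dEta y ξ 0) (fun ξ => dEta v ξ 0)
      = dXi (dEta y) 0 0 * dXi (dEta v) 0 0 + ∫ ξ in I, dXi (d21 y) ξ 0 * dXi (d21 v) ξ 0 := by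
    rw [inner3, l1 0 zero_mem_I, r1 0 zero_mem_I, intervalIntegral_eq_Icc zero_le_one]
    simp only [zero_mul, zero_add, add_zero]
    rfl
  rw [inner32, t1, t3, t4, t5, intervalIntegral_eq_Icc zero_le_one]
  simp only [zero_add, add_zero]
  rw [← add_assoc]
  rfl

lemma integral_mul_congr_ae {Ω : Type*} [MeasurableSpace Ω] {μ : Measure Ω} {f f' g g' : Ω → ℝ}
    (hf : f =ᵐ[μ] f') (hg : g =ᵐ[μ] g') : ∫ ω, f ω * g ω ∂μ = ∫ ω, f' ω * g' ω ∂μ :=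
  integral_congr_ae (hf.mul hg)

/-- Synthesis is isometric. -/
lemma IsSynth.inner32_eq {h k : ℝ × ℝ → ℝ} {y v : ℝ → ℝ → ℝ} (H : IsSynth h y)
    (G : IsSynth k v) : inner32 y v = ∫ p, h p * k p ∂atomSq := by
  -- The four surviving terms of the inner product match the four strata.
  rw [H.memW32.inner32_eq, integral_atomSq (f := fun p => h p * k p)
    (H.memLp.integrable_mul G.memLp),
    H.dXi_dEta_eq 0 zero_mem_I 0 zero_mem_I, G.dXi_dEta_eq 0 zero_mem_I 0 zero_mem_I,
    kInt_dphi3_zero H.integrable zero_mem_I, kInt_dphi3_zero G.integrable zero_mem_I,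
    integral_mul_congr_ae H.dEta_dEta_dXi_ae G.dEta_dEta_dXi_ae,
    integral_mul_congr_ae H.dXi_d21_ae G.dXi_d21_ae, integral_mul_congr_ae H.d32_ae G.d32_ae]
  simp only [intervalIntegral.integral_same, add_zero]
  ring

/-! ### Every function of the space is synthesized. -/

lemma eq_zero_of_hasDerivWithinAt_zero {u : ℝ → ℝ} (h0 : u 0 = 0)
    (hu : ∀ x ∈ I, HasDerivWithinAt u 0 I x) : ∀ x ∈ I, u x = 0 := fun x hx => by
  rw [← h0]
  exact constant_of_derivWithin_zero (fun y hy => (hu y hy).differentiableWithinAt)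
    (fun y hy => (hu y (Ico_subset_Icc_self hy)).derivWithin
      (uniqueDiffOn_I y (Ico_subset_Icc_self hy))) x hx

/-- A function with constant second derivative, vanishing at both ends of `[0,1]`. -/
lemma eq_of_second_deriv_const {u u' : ℝ → ℝ} {C : ℝ} (hu : ∀ x ∈ I, HasDerivWithinAt u (u' x) I x)
    (hu' : ∀ x ∈ I, HasDerivWithinAt u' C I x) (h0 : u 0 = 0) (h1 : u 1 = 0) :
    ∀ x ∈ I, u x = (x - x ^ 2) * (-C / 2) := by
  have e1 : ∀ x ∈ I, u' x - u' 0 - C * x = 0 :=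
    eq_zero_of_hasDerivWithinAt_zero (by simp) fun x hx => by
      exact (((hu' x hx).sub_const (u' 0)).sub
        ((hasDerivWithinAt_id x I).const_mul C)).congr_deriv (by simp)
  have e2 : ∀ x ∈ I, u x - (u' 0 * x + C / 2 * x ^ 2) = 0 :=
    eq_zero_of_hasDerivWithinAt_zero (by simp [h0]) fun x hx => by
      have h := (hu x hx).sub (((hasDerivWithinAt_id x I).const_mul (u' 0)).add
        (((hasDerivWithinAt_id x I).pow 2).const_mul (C / 2)))
      refine h.congr_deriv ?_
      have := e1 x hx
      simp only [id]
      push_cast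
      linarith
  intro x hx
  have h3 := e2 1 one_mem_I
  have h4 := e2 x hx
  rw [h1] at h3
  have h5 : u' 0 = -C / 2 := by linarith
  rw [h5] at h4
  linarith

lemma intervalIntegral_congr_ae_I {f g : ℝ → ℝ} (h : f =ᵐ[volume.restrict I] g) {x : ℝ}
    (hx : x ∈ I) : ∫ r in (0 : ℝ)..x, f r = ∫ r in (0 : ℝ)..x, g r := by
  rw [intervalIntegral_eq_Icc hx.1, intervalIntegral_eq_Icc hx.1]
  exact integral_congr_ae
    (ae_restrict_of_ae_restrict_of_subset (show Icc 0 x ⊆ I from Icc_subset_Icc_right hx.2) h)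

lemma setIntegral_rect_congr_ae {f g : ℝ × ℝ → ℝ} (h : f =ᵐ[volume.restrict D] g) {x t : ℝ}
    (hx : x ∈ I) (ht : t ∈ I) :
    ∫ p in Icc 0 x ×ˢ Icc 0 t, f p = ∫ p in Icc 0 x ×ˢ Icc 0 t, g p :=
  integral_congr_ae (ae_restrict_of_ae_restrict_of_subset
    (show Icc 0 x ×ˢ Icc 0 t ⊆ D from
      prod_mono (Icc_subset_Icc_right hx.2) (Icc_subset_Icc_right ht.2)) h)

lemma glue_add (p₀ q₀ : ℝ) (g g' a a' : ℝ → ℝ) (c c' : ℝ × ℝ → ℝ) (p : ℝ × ℝ) :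
    glue (p₀ + q₀) (g + g') (a + a') (c + c') p = glue p₀ g a c p + glue q₀ g' a' c' p := by
  unfold glue; split_ifs <;> simp

/-- Data on the left edge and corner alone sit on the atom in `r`, so the transform separates into a
function of `x` times a primitive in `t`. -/
lemma kInt_dphi2_glue_left {A : ℝ → ℝ → ℝ} (hA : IsKernel A) {p₀ : ℝ} {g : ℝ → ℝ}
    (hg : MemLp g 2 (volume.restrict I)) {x t : ℝ} (hx : x ∈ I) (ht : t ∈ I) :
    kInt A dphi2 (glue p₀ g 0 0) x t = A x 0 * (p₀ + ∫ s in (0 : ℝ)..t, g s) := by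
  have hm : MemLp (glue p₀ g 0 0) 2 atomSq := memLp_glue p₀ hg MemLp.zero MemLp.zero
  have e : ∀ s, ∫ r, A x r * glue p₀ g 0 0 (r, s) ∂atomMeasure = A x 0 * glue p₀ g 0 0 (0, s) :=
    fun s => integral_atomMeasure_of_eq_zero fun r _ h0 => by simp [glue, h0]
  rw [kInt_dphi2 hA (hm.integrable (by norm_num)) hx ht]
  simp only [e]
  rw [intervalIntegral.integral_const_mul, glue_zero,
    intervalIntegral_congr_ae_I (glue_ae_left p₀ g 0 0) ht, mul_add]

/-- Every function in the space is synthesized from its derivative data. -/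
theorem MemW32.exists_isSynth {y : ℝ → ℝ → ℝ} (hy : MemW32 y) : ∃ h, IsSynth h y := by
  obtain ⟨hacb, hacl, hex⟩ := hy.complCont
  have hc : IsMixedDensity (d21 y) (d32 y) := isMixedDensity_mixedDeriv hex
  set c := d32 y with hcdef
  set a : ℝ → ℝ := fun ξ => dXi (d21 y) ξ 0 with hadef
  -- `y₀` carries the data of the square and of the bottom edge; the rest of `y` must come from the
  -- left edge and the corner.
  have H0 : IsSynth (glue 0 0 a c) (synth (glue 0 0 a c)) :=
    ⟨memLp_glue 0 MemLp.zero hy.sq_int_bottom hy.sq_int, fun _ _ _ _ => rfl⟩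
  set y₀ := synth (glue 0 0 a c) with hy₀
  -- Mixed density and bottom-edge derivative agree, so the `d21` of the difference does not depend
  -- on `ξ`.
  have hdiff : ∀ ξ ∈ I, ∀ η ∈ I, d21 y ξ η - d21 y₀ ξ η = d21 y 0 η - d21 y₀ 0 η := by
    intro ξ hξ η hη
    have h1 := hc.2 ξ hξ η hη
    have h2 := (eq_integral_der_of_absolutelyContinuous hacb).2 ξ hξ
    have h3 := kInt_ddphi3_sub H0.integrable hξ hη
    rw [intervalIntegral_congr_ae_I (glue_ae_bottom 0 0 a c) hξ,
      setIntegral_rect_congr_ae (glue_ae_D 0 0 a c) hξ hη, ← H0.d21_eq ξ hξ η hη,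
      ← H0.d21_eq 0 zero_mem_I η hη] at h3
    have h4 : ∫ r in (0 : ℝ)..ξ, a r = ∫ r in (0 : ℝ)..ξ, der (fun ξ => d21 y ξ 0) r := rfl
    linarith
  set B : ℝ → ℝ := fun η => d21 y 0 η - d21 y₀ 0 η with hB
  have hBac : AbsolutelyContinuousOnInterval B 0 1 :=
    AbsolutelyContinuousOnInterval.fun_sub hacl H0.memW32.complCont.2.1
  have M0 := H0.memW32
  -- For fixed `η` the difference has constant second `ξ`-derivative and vanishes at both ends,
  -- hence is a multiple of `ξ - ξ²`.
  have key : ∀ ξ ∈ I, ∀ η ∈ I, dEta y ξ η - dEta y₀ ξ η = (ξ - ξ ^ 2) * (-B η / 2) := by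
    intro ξ hξ η hη
    refine eq_of_second_deriv_const (u := fun ξ => dEta y ξ η - dEta y₀ ξ η)
      (u' := fun ξ => dXi (dEta y) ξ η - dXi (dEta y₀) ξ η) (C := B η) ?_ ?_ ?_ ?_ ξ hξ
    · intro x hx
      exact (hy.diff_xi_eta η hη x hx).hasDerivWithinAt.sub
        (M0.diff_xi_eta η hη x hx).hasDerivWithinAt
    · intro x hx
      have e : B η = d21 y x η - d21 y₀ x η := (hdiff x hx η hη).symm
      rw [e]
      exact (hy.diff_xi_xi_eta η hη x hx).hasDerivWithinAt.sub
        (M0.diff_xi_xi_eta η hη x hx).hasDerivWithinAt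
    · have h1 := der_eq_zero_of_eqOn hy.left η hη
      have h2 := der_eq_zero_of_eqOn M0.left η hη
      simp only [dEta, h1, h2, sub_self]
    · have h1 := der_eq_zero_of_eqOn hy.right η hη
      have h2 := der_eq_zero_of_eqOn M0.right η hη
      simp only [dEta, h1, h2, sub_self]
  have hder : ∀ ξ ∈ I, ∀ η ∈ I,
      HasDerivWithinAt (fun η => y ξ η - y₀ ξ η) ((ξ - ξ ^ 2) * (-B η / 2)) I η := by
    intro ξ hξ η hη
    rw [← key ξ hξ η hη]
    exact (hy.diff_eta ξ hξ η hη).hasDerivWithinAt.sub (M0.diff_eta ξ hξ η hη).hasDerivWithinAt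
  have half_mem : (1 / 2 : ℝ) ∈ I := ⟨by norm_num, by norm_num⟩
  -- The factor 4 normalizes `ξ - ξ² = 1/4` at `ξ = 1/2`; sampling there gives a primitive of `-B/2`
  -- without integrating.
  set Q : ℝ → ℝ := fun η => 4 * (y (1 / 2) η - y₀ (1 / 2) η) with hQ
  have hQder : ∀ η ∈ I, HasDerivWithinAt Q (-B η / 2) I η := fun η hη =>
    ((hder _ half_mem η hη).const_mul 4).congr_deriv (by ring)
  have hsplit : ∀ ξ ∈ I, ∀ η ∈ I, y ξ η = y₀ ξ η + (ξ - ξ ^ 2) * Q η := by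
    intro ξ hξ η hη
    have := eq_zero_of_hasDerivWithinAt_zero
      (u := fun η => y ξ η - y₀ ξ η - (ξ - ξ ^ 2) * Q η) (by
        simp only [hQ, hy.bottom ξ hξ, M0.bottom ξ hξ, hy.bottom _ half_mem, M0.bottom _ half_mem]
        ring) (fun η hη => ((hder ξ hξ η hη).sub ((hQder η hη).const_mul (ξ - ξ ^ 2))).congr_deriv
          (by ring)) η hη
    linarith
  -- Membership does not postulate that `y` is differentiable in `ξ`, nor that mixed derivatives
  -- commute; both at `ξ = 0` are read off from the splitting `hsplit`.
  have hdXi : ∀ η ∈ I, dXi y 0 η = dXi y₀ 0 η + Q η := by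
    intro η hη
    have h1 := hasDerivWithinAt_fst_of_eqOn H0.eq isKernel_phi3
      hasKernelDeriv_phi3 isKernel_phi2 H0.integrable zero_mem_I hη
    have h2 : HasDerivWithinAt (fun ξ : ℝ => (ξ - ξ ^ 2) * Q η) (Q η) I 0 :=
      (((hasDerivWithinAt_id (0 : ℝ) I).sub ((hasDerivWithinAt_id (0 : ℝ) I).pow 2)).mul_const
        (Q η)).congr_deriv (by simp)
    rw [H0.dXi_eq 0 zero_mem_I η hη]
    exact ((h1.add h2).congr (fun ξ hξ => hsplit ξ hξ η hη)
      (hsplit 0 zero_mem_I η hη)).derivWithin (uniqueDiffOn_I 0 zero_mem_I)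
  have hdEtadXi : ∀ η ∈ I, dEta (dXi y) 0 η = -B η / 2 := by
    intro η hη
    have h1 := hasDerivWithinAt_snd_of_eqOn H0.dXi_eq isKernel_dphi3 isKernel_phi2
      hasKernelDeriv_phi2 H0.integrable zero_mem_I hη
    have h2 : kInt dphi3 dphi2 (glue 0 0 a c) 0 η = 0 := by
      rw [kInt_dphi3_zero H0.integrable hη]
      simp [glue]
    rw [h2] at h1
    have h3 := (h1.add (hQder η hη)).congr hdXi (hdXi η hη)
    rw [zero_add] at h3
    exact h3.derivWithin (uniqueDiffOn_I η hη)
  -- The missing data are `u 0` at the corner and `u'` on the left edge. Absolute continuity of `u`,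
  -- inherited from `B`, lets these recover `u`.
  set u : ℝ → ℝ := fun η => dEta (dXi y) 0 η with hu
  have huac : AbsolutelyContinuousOnInterval u 0 1 := by
    refine absolutelyContinuousOnInterval_congr (v := fun η => (-1 / 2) * B η) (fun η hη => ?_)
      (hBac.const_mul _)
    rw [hu]
    simp only [hdEtadXi η hη]
    ring
  have huint := (eq_integral_der_of_absolutelyContinuous huac).2
  set g : ℝ → ℝ := der u with hg
  have hgL : MemLp g 2 (volume.restrict I) := hy.sq_int_left
  have hm : MemLp (glue (u 0) g a c) 2 atomSq := memLp_glue (u 0) hgL hy.sq_int_bottom hy.sq_int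
  refine ⟨glue (u 0) g a c, hm, fun ξ hξ η hη => ?_⟩
  have G : IsSynth (glue (u 0) g a c) (synth (glue (u 0) g a c)) := ⟨hm, fun _ _ _ _ => rfl⟩
  have hm1 : MemLp (glue (u 0) g 0 0) 2 atomSq := memLp_glue (u 0) hgL MemLp.zero MemLp.zero
  have hadd : (glue (u 0) g a c) = fun p => glue 0 0 a c p + glue (u 0) g 0 0 p := by
    funext p
    rw [← glue_add]
    simp
  -- Both functions vanish at `η = 0`, so comparing their `η`-derivatives is enough.
  refine sub_eq_zero.1 (eq_zero_of_hasDerivWithinAt_zero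
    (u := fun η => y ξ η - synth (glue (u 0) g a c) ξ η)
    (by simp [hy.bottom ξ hξ, G.memW32.bottom ξ hξ]) (fun η hη => ?_) η hη)
  refine ((hy.diff_eta ξ hξ η hη).hasDerivWithinAt.sub
    (G.memW32.diff_eta ξ hξ η hη).hasDerivWithinAt).congr_deriv ?_
  have e1 := G.dEta_eq ξ hξ η hη
  have e2 : kInt phi3 dphi2 (glue (u 0) g a c) ξ η
      = kInt phi3 dphi2 (glue 0 0 a c) ξ η + kInt phi3 dphi2 (glue (u 0) g 0 0) ξ η := by
    rw [hadd]
    exact kInt_add isKernel_phi3 isKernel_dphi2 H0.integrable (hm1.integrable (by norm_num)) hξ hη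
  rw [e2, kInt_dphi2_glue_left isKernel_phi3 hgL hξ hη, ← huint η hη, ← H0.dEta_eq ξ hξ η hη] at e1
  have e3 : phi3 ξ 0 = ξ - ξ ^ 2 := if_pos rfl
  have e4 : u η = -B η / 2 := hdEtadXi η hη
  have e5 := key ξ hξ η hη
  rw [e3, e4] at e1
  change dEta y ξ η - dEta (synth (glue (u 0) g a c)) ξ η = 0
  linarith

/-! ### The closed form of the reproducing kernel. -/

lemma integral_quartic (c₀ c₁ c₂ c₃ c₄ a b : ℝ) :
    ∫ r in a..b, (c₀ + c₁ * r + c₂ * r ^ 2 + c₃ * r ^ 3 + c₄ * r ^ 4)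
      = (c₀ * b + c₁ * b ^ 2 / 2 + c₂ * b ^ 3 / 3 + c₃ * b ^ 4 / 4 + c₄ * b ^ 5 / 5)
        - (c₀ * a + c₁ * a ^ 2 / 2 + c₂ * a ^ 3 / 3 + c₃ * a ^ 4 / 4 + c₄ * a ^ 5 / 5) := by
  refine intervalIntegral.integral_eq_sub_of_hasDerivAt
    (f := fun b => c₀ * b + c₁ * b ^ 2 / 2 + c₂ * b ^ 3 / 3 + c₃ * b ^ 4 / 4 + c₄ * b ^ 5 / 5)
    (fun x _ => ?_) (Continuous.intervalIntegrable (by fun_prop) _ _)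
  have h (n : ℕ) := hasDerivAt_pow n x
  refine ((((((hasDerivAt_id x).const_mul c₀).add (((h 2).const_mul c₁).div_const 2)).add
    (((h 3).const_mul c₂).div_const 3)).add (((h 4).const_mul c₃).div_const 4)).add
    (((h 5).const_mul c₄).div_const 5)).congr_deriv ?_
  norm_num
  ring

lemma integral_atomMeasure_mul {A B : ℝ → ℝ → ℝ} (hA : IsKernel A) (hB : IsKernel B) {x y : ℝ}
    (hx : x ∈ I) (hy : y ∈ I) :
    ∫ r, A x r * B y r ∂atomMeasure = (∫ r in (0 : ℝ)..1, A x r * B y r) + A x 0 * B y 0 := by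
  obtain ⟨C, hC0, hC⟩ := hA.nonneg_bdd
  obtain ⟨C', -, hC'⟩ := hB.nonneg_bdd
  have hi : Integrable (fun r => A x r * B y r) atomMeasure := by
    refine Integrable.of_bound ((hA.meas x).mul (hB.meas y)).aestronglyMeasurable (C * C') ?_
    filter_upwards [ae_mem_I] with r hr
    rw [Real.norm_eq_abs, abs_mul]
    exact mul_le_mul (hC x hx r hr) (hC' y hy r hr) (abs_nonneg _) hC0
  rw [atomMeasure] at hi ⊢
  rw [integral_add_measure hi.left_of_add_measure hi.right_of_add_measure, integral_dirac,
    intervalIntegral_eq_Icc zero_le_one]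
  rfl

lemma R2_eq_of_le {t η : ℝ} (ht : t ∈ I) (hη : η ∈ I) (hle : η ≤ t) :
    R2 t η = ∫ s, phi2 t s * phi2 η s ∂atomMeasure := by
  rw [integral_atomMeasure_mul isKernel_phi2 isKernel_phi2 ht hη]
  have hc : Continuous fun s => phi2 t s * phi2 η s := by unfold phi2; fun_prop
  have h0 : phi2 t 0 * phi2 η 0 = t * η := by
    simp [phi2, max_eq_left ht.1, max_eq_left hη.1]
  have h1 : ∫ s in (0 : ℝ)..η, phi2 t s * phi2 η s
      = ∫ s in (0 : ℝ)..η, (t * η + (-(t + η)) * s + 1 * s ^ 2 + 0 * s ^ 3 + 0 * s ^ 4) := by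
    refine intervalIntegral.integral_congr fun s hs => ?_
    rw [uIcc_of_le hη.1] at hs
    have e1 : max (t - s) 0 = t - s := max_eq_left (by linarith [hs.2])
    have e2 : max (η - s) 0 = η - s := max_eq_left (by linarith [hs.2])
    simp only [phi2, e1, e2]
    ring
  have h2 : ∫ s in η..1, phi2 t s * phi2 η s = ∫ s in η..1, (0 : ℝ) := by
    refine intervalIntegral.integral_congr fun s hs => ?_
    rw [uIcc_of_le hη.2] at hs
    have e2 : max (η - s) 0 = 0 := max_eq_right (by linarith [hs.1])
    simp [phi2, e2]
  rw [← intervalIntegral.integral_add_adjacent_intervals (hc.intervalIntegrable 0 η)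
    (hc.intervalIntegrable η 1), h1, h2, integral_quartic, h0, R2, if_pos hle]
  simp only [intervalIntegral.integral_zero]
  ring

lemma R2_comm (t η : ℝ) : R2 t η = R2 η t := by
  unfold R2
  split_ifs with h1 h2 h2
  · rw [le_antisymm h1 h2]
  · ring
  · ring
  · linarith

lemma R3_comm (x ξ : ℝ) : R3 x ξ = R3 ξ x := by
  unfold R3
  split_ifs with h1 h2 h2
  · rw [le_antisymm h1 h2]
  · ring
  · ring
  · linarith

lemma R2_eq {t η : ℝ} (ht : t ∈ I) (hη : η ∈ I) :
    R2 t η = ∫ s, phi2 t s * phi2 η s ∂atomMeasure := by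
  rcases le_total η t with h | h
  · exact R2_eq_of_le ht hη h
  · rw [R2_comm, R2_eq_of_le hη ht h]
    simp only [mul_comm]

lemma R3_eq_of_le {x ξ : ℝ} (hx : x ∈ I) (hξ : ξ ∈ I) (hle : ξ ≤ x) :
    R3 x ξ = ∫ r, phi3 x r * phi3 ξ r ∂atomMeasure := by
  rw [integral_atomMeasure_mul isKernel_phi3 isKernel_phi3 hx hξ]
  have e0 : phi3 x 0 * phi3 ξ 0 = (x - x ^ 2) * (ξ - ξ ^ 2) := by simp [phi3]
  set G : ℝ → ℝ := fun r => (max (x - r) 0 ^ 2 / 2 - x ^ 2 * (1 - r) ^ 2 / 2)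
    * (max (ξ - r) 0 ^ 2 / 2 - ξ ^ 2 * (1 - r) ^ 2 / 2) with hG
  have hc : Continuous G := by fun_prop
  -- The special value of `phi3` at `r = 0` matters only for the atom; the Lebesgue part may use the
  -- continuous formula `G`.
  have hphi : ∫ r in (0 : ℝ)..1, phi3 x r * phi3 ξ r = ∫ r in (0 : ℝ)..1, G r := by
    refine intervalIntegral_congr_ae_I ?_ one_mem_I
    filter_upwards [ae_I_ne_zero] with r h0
    simp [phi3, h0, hG]
  -- The coefficients come from `(x-r)² - x²(1-r)² = -r(1-x)(2x-(1+x)r)`, used here for both factors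
  -- and on `[ξ,x]` for the first one.
  have h1 : ∫ r in (0 : ℝ)..ξ, G r = ∫ r in (0 : ℝ)..ξ, (0 + 0 * r
      + ((1 - x) * (1 - ξ) * x * ξ) * r ^ 2
      + (-(1 - x) * (1 - ξ) * (ξ * (1 + x) + x * (1 + ξ)) / 2) * r ^ 3
      + ((1 - x) * (1 - ξ) * (1 + x) * (1 + ξ) / 4) * r ^ 4) := by
    refine intervalIntegral.integral_congr fun r hr => ?_
    rw [uIcc_of_le hξ.1] at hr
    have e1 : max (x - r) 0 = x - r := max_eq_left (by linarith [hr.2])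
    have e2 : max (ξ - r) 0 = ξ - r := max_eq_left (by linarith [hr.2])
    simp only [hG, e1, e2]
    ring
  have h2 : ∫ r in ξ..x, G r = ∫ r in ξ..x, (0 + (-2 * x * (-ξ ^ 2 * (1 - x) / 4)) * r
      + ((1 + x + 4 * x) * (-ξ ^ 2 * (1 - x) / 4)) * r ^ 2
      + ((-2 * (1 + x) - 2 * x) * (-ξ ^ 2 * (1 - x) / 4)) * r ^ 3
      + ((1 + x) * (-ξ ^ 2 * (1 - x) / 4)) * r ^ 4) := by
    refine intervalIntegral.integral_congr fun r hr => ?_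
    rw [uIcc_of_le hle] at hr
    have e1 : max (x - r) 0 = x - r := max_eq_left (by linarith [hr.2])
    have e2 : max (ξ - r) 0 = 0 := max_eq_right (by linarith [hr.1])
    simp only [hG, e1, e2]
    ring
  have h3 : ∫ r in x..1, G r = ∫ r in x..1, (x ^ 2 * ξ ^ 2 / 4 + (-4 * (x ^ 2 * ξ ^ 2 / 4)) * r
      + (6 * (x ^ 2 * ξ ^ 2 / 4)) * r ^ 2 + (-4 * (x ^ 2 * ξ ^ 2 / 4)) * r ^ 3
      + (x ^ 2 * ξ ^ 2 / 4) * r ^ 4) := by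
    refine intervalIntegral.integral_congr fun r hr => ?_
    rw [uIcc_of_le hx.2] at hr
    have e1 : max (x - r) 0 = 0 := max_eq_right (by linarith [hr.1])
    have e2 : max (ξ - r) 0 = 0 := max_eq_right (by linarith [hr.1])
    simp only [hG, e1, e2]
    ring
  rw [hphi, ← intervalIntegral.integral_add_adjacent_intervals (hc.intervalIntegrable 0 ξ)
    (hc.intervalIntegrable ξ 1), ← intervalIntegral.integral_add_adjacent_intervals
    (hc.intervalIntegrable ξ x) (hc.intervalIntegrable x 1), h1, h2, h3, integral_quartic,
    integral_quartic, integral_quartic, e0, R3, if_pos hle]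
  ring

lemma R3_eq {x ξ : ℝ} (hx : x ∈ I) (hξ : ξ ∈ I) :
    R3 x ξ = ∫ r, phi3 x r * phi3 ξ r ∂atomMeasure := by
  rcases le_total ξ x with h | h
  · exact R3_eq_of_le hx hξ h
  · rw [R3_comm, R3_eq_of_le hξ hx h]
    simp only [mul_comm]

/-- The derivative data of the reproducing kernel. -/
def kernelData (x t : ℝ) (p : ℝ × ℝ) : ℝ := phi3 x p.1 * phi2 t p.2

lemma K_comm (x t ξ η : ℝ) : K x t ξ η = K ξ η x t := by
  rw [K, K, R3_comm, R2_comm]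

lemma isSynth_K {x t : ℝ} (hx : x ∈ I) (ht : t ∈ I) : IsSynth (kernelData x t) (K x t) := by
  refine ⟨isKernel_phi3.memLp isKernel_phi2 hx ht, fun ξ hξ η hη => ?_⟩
  rw [K_comm, K, R3_eq hξ hx, R2_eq hη ht, ← integral_prod_mul]
  refine integral_congr_ae (Eventually.of_forall fun p => ?_)
  simp only [kernelData]
  ring

/-- `psi` applies `L` to the kernel in its parameters; by symmetry this is again a function of the
space with known data. -/
lemma isSynth_K' {x t : ℝ} (hx : x ∈ I) (ht : t ∈ I) :
    IsSynth (kernelData x t) (fun ξ η => K ξ η x t) := by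
  simp only [fun ξ η => K_comm ξ η x t]
  exact isSynth_K hx ht

lemma synth_eq_integral (h : ℝ × ℝ → ℝ) (x t : ℝ) :
    synth h x t = ∫ p, kernelData x t p * h p ∂atomSq := rfl

/-- The transform at `(x,t)` is by definition the `L²` pairing of the data with `kernelData x t`, so
the isometry gives the reproducing property. -/
theorem isReproducingKernel_K : IsReproducingKernel K := fun x hx t ht => by
  refine ⟨(isSynth_K hx ht).memW32, fun y hy => ?_⟩
  obtain ⟨h, H⟩ := hy.exists_isSynth
  rw [H.inner32_eq (isSynth_K hx ht), H.eq x hx t ht, synth_eq_integral]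
  simp only [mul_comm]

/-! ### Bounded functionals on the data space. -/

/-- The Hilbert space of derivative data. -/
abbrev DataSpace : Type := Lp ℝ 2 atomSq

lemma inner_dataSpace (h k : DataSpace) : inner ℝ h k = ∫ p, h p * k p ∂atomSq := by
  rw [L2.inner_def]
  refine integral_congr_ae (Eventually.of_forall fun p => ?_)
  simp [mul_comm]

lemma integrable_dataSpace (h : DataSpace) : Integrable h atomSq :=
  (Lp.memLp h).integrable (by norm_num)

/-- The kernels are bounded and the measure is finite, so Cauchy–Schwarz against the constant 1
bounds the transform by the `L²` norm, uniformly over `D`. -/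
lemma exists_abs_kInt_le {A B : ℝ → ℝ → ℝ} (hA : IsKernel A) (hB : IsKernel B) :
    ∃ C, 0 ≤ C ∧ ∀ h : DataSpace, ∀ x ∈ I, ∀ t ∈ I, |kInt A B h x t| ≤ C * ‖h‖ := by
  obtain ⟨C, hC0, hC⟩ := hA.mul_bdd hB
  set one : DataSpace := (memLp_const (1 : ℝ)).toLp _ with hone
  refine ⟨C * ‖one‖, by positivity, fun h x hx t ht => ?_⟩
  have h1 : ∫ p, |h p| ∂atomSq = inner ℝ one |h| := by
    rw [inner_dataSpace]
    refine integral_congr_ae ?_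
    filter_upwards [(memLp_const (1 : ℝ) : MemLp (fun _ : ℝ × ℝ => (1 : ℝ)) 2 atomSq).coeFn_toLp,
      Lp.coeFn_abs h] with p e1 e2
    rw [e2, hone, e1, one_mul]
  have h2 : ∫ p, |h p| ∂atomSq ≤ ‖one‖ * ‖h‖ := by
    rw [h1, ← norm_abs_eq_norm h]
    exact real_inner_le_norm _ _
  calc |kInt A B h x t| ≤ ∫ p, C * |h p| ∂atomSq := by
        rw [← Real.norm_eq_abs]
        refine norm_integral_le_of_norm_le ((integrable_dataSpace h).abs.const_mul C) ?_
        filter_upwards [hC x hx t ht] with p hp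
        rw [Real.norm_eq_abs, abs_mul]
        exact mul_le_mul_of_nonneg_right hp (abs_nonneg _)
    _ = C * ∫ p, |h p| ∂atomSq := integral_const_mul _ _
    _ ≤ C * (‖one‖ * ‖h‖) := mul_le_mul_of_nonneg_left h2 hC0
    _ = _ := by ring

/-- The functional `Λ` on derivative data is represented by integration against some `k`. -/
def IsRepresentable (Λ : DataSpace → ℝ) : Prop := ∃ k : DataSpace, ∀ h, Λ h = inner ℝ k h

lemma IsRepresentable.add {Λ Γ : DataSpace → ℝ} (h : IsRepresentable Λ) (g : IsRepresentable Γ) :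
    IsRepresentable (fun z => Λ z + Γ z) := by
  obtain ⟨k, hk⟩ := h
  obtain ⟨l, hl⟩ := g
  exact ⟨k + l, fun z => by simp only [hk, hl, inner_add_left]⟩

lemma IsRepresentable.const_mul {Λ : DataSpace → ℝ} (c : ℝ) (h : IsRepresentable Λ) :
    IsRepresentable (fun z => c * Λ z) := by
  obtain ⟨k, hk⟩ := h
  exact ⟨c • k, fun z => by simp only [hk, real_inner_smul_left]⟩

/-- The Riesz representation theorem. -/
lemma isRepresentable_of_bound {Λ : DataSpace → ℝ} {C : ℝ} (hadd : ∀ h k, Λ (h + k) = Λ h + Λ k)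
    (hsmul : ∀ (c : ℝ) h, Λ (c • h) = c * Λ h) (hC : ∀ h, |Λ h| ≤ C * ‖h‖) :
    IsRepresentable Λ := by
  let f : DataSpace →ₗ[ℝ] ℝ := { toFun := Λ, map_add' := hadd, map_smul' := hsmul }
  let F := f.mkContinuous C hC
  exact ⟨(InnerProductSpace.toDual ℝ DataSpace).symm F, fun h => by
    rw [InnerProductSpace.toDual_symm_apply]; rfl⟩

section

variable {A B : ℝ → ℝ → ℝ} {x t : ℝ}

lemma kInt_add_dataSpace (hA : IsKernel A) (hB : IsKernel B) (hx : x ∈ I) (ht : t ∈ I)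
    (h k : DataSpace) : kInt A B (h + k : DataSpace) x t = kInt A B h x t + kInt A B k x t := by
  rw [kInt_congr_ae (Lp.coeFn_add h k)]
  exact kInt_add hA hB (integrable_dataSpace h) (integrable_dataSpace k) hx ht

lemma kInt_smul_dataSpace (c : ℝ) (h : DataSpace) :
    kInt A B (c • h : DataSpace) x t = c * kInt A B h x t := by
  rw [kInt_congr_ae (Lp.coeFn_smul c h)]
  exact kInt_smul c

lemma isRepresentable_kInt (hA : IsKernel A) (hB : IsKernel B) (hx : x ∈ I) (ht : t ∈ I) :
    IsRepresentable (fun h => kInt A B h x t) := by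
  obtain ⟨C, -, hC⟩ := exists_abs_kInt_le hA hB
  exact isRepresentable_of_bound (C := C) (kInt_add_dataSpace hA hB hx ht)
    (fun c h => kInt_smul_dataSpace c h) (fun h => hC h x hx t ht)

end

/-! ### The Caputo derivative. -/

lemma mul_mem_I {t s : ℝ} (ht : t ∈ I) (hs : s ∈ I) : t * s ∈ I :=
  ⟨mul_nonneg ht.1 hs.1, mul_le_one₀ ht.2 hs.1 hs.2⟩

lemma intervalIntegrable_weight {α : ℝ} (hα : α < 1) :
    IntervalIntegrable (fun s : ℝ => 1 / (1 - s) ^ α) volume 0 1 := by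
  have h1 : IntervalIntegrable (fun s : ℝ => s ^ (-α)) volume 0 1 :=
    intervalIntegral.intervalIntegrable_rpow' (by linarith)
  have h2 := (h1.comp_sub_left 1).symm
  rw [sub_zero, sub_self] at h2
  refine h2.congr fun s hs => ?_
  rw [uIoc_of_le zero_le_one] at hs
  rw [Real.rpow_neg (by linarith [hs.2]), one_div]

/-- The weakly singular integral of the Caputo derivative on a fixed interval. -/
lemma caputo_eq_of_lt {α : ℝ} (hα : α < 1) {u w : ℝ → ℝ} (hu : ∀ r ∈ I, der u r = w r)
    {t : ℝ} (ht : t ∈ I) :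
    caputo α u t
      = 1 / Real.Gamma (1 - α) * (t ^ (1 - α) * ∫ s in (0 : ℝ)..1, w (t * s) * (1 / (1 - s) ^ α)) := by
  rw [caputo, if_neg hα.ne]
  congr 1
  rcases ht.1.eq_or_lt with h0 | h0
  -- At `t = 0` both sides vanish, the right one because `1 - α ≠ 0`.
  · rw [← h0, Real.zero_rpow (by linarith)]
    simp
  -- The substitution `r = t s` moves the singularity to the fixed point `s = 1`, with a weight
  -- independent of `t`.
  have h1 := intervalIntegral.mul_integral_comp_mul_left
    (f := fun r => der u r / (t - r) ^ α) (a := 0) (b := 1) t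
  rw [mul_zero, mul_one] at h1
  have h2 : ∫ s in (0 : ℝ)..1, der u (t * s) / (t - t * s) ^ α
      = (1 / t ^ α) * ∫ s in (0 : ℝ)..1, w (t * s) * (1 / (1 - s) ^ α) := by
    rw [← intervalIntegral.integral_const_mul]
    refine intervalIntegral.integral_congr fun s hs => ?_
    rw [uIcc_of_le zero_le_one] at hs
    rw [hu _ (mul_mem_I ht hs), show t - t * s = t * (1 - s) by ring,
      Real.mul_rpow h0.le (by linarith [hs.2])]
    field_simp
  rw [← h1, h2, Real.rpow_sub h0, Real.rpow_one]
  field_simp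

section

variable {A B : ℝ → ℝ → ℝ} {x t α : ℝ}

lemma intervalIntegrable_kInt_weight (hα : α < 1) (hA : IsKernel A) (hB : IsKernel B)
    (hx : x ∈ I) (ht : t ∈ I) {h : ℝ × ℝ → ℝ} (hh : Integrable h atomSq) :
    IntervalIntegrable (fun s => kInt A B h x (t * s) * (1 / (1 - s) ^ α)) volume 0 1 := by
  refine (intervalIntegrable_weight hα).continuousOn_mul ?_
  rw [uIcc_of_le zero_le_one]
  exact (continuousOn_kInt hA hB hh).comp
    (f := fun s : ℝ => (x, t * s)) (by fun_prop) fun s hs => ⟨hx, mul_mem_I ht hs⟩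

lemma isRepresentable_integral_weight (hα : α < 1) (hA : IsKernel A) (hB : IsKernel B)
    (hx : x ∈ I) (ht : t ∈ I) : IsRepresentable
      (fun h => ∫ s in (0 : ℝ)..1, kInt A B h x (t * s) * (1 / (1 - s) ^ α)) := by
  obtain ⟨C, -, hC⟩ := exists_abs_kInt_le hA hB
  refine isRepresentable_of_bound (C := C * ∫ s in (0 : ℝ)..1, 1 / (1 - s) ^ α) ?_ ?_ ?_
  · intro h k
    rw [← intervalIntegral.integral_add
      (intervalIntegrable_kInt_weight hα hA hB hx ht (integrable_dataSpace h))
      (intervalIntegrable_kInt_weight hα hA hB hx ht (integrable_dataSpace k))]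
    refine intervalIntegral.integral_congr fun s hs => ?_
    rw [uIcc_of_le zero_le_one] at hs
    rw [kInt_add_dataSpace hA hB hx (mul_mem_I ht hs), add_mul]
  · intro c h
    rw [← intervalIntegral.integral_const_mul]
    refine intervalIntegral.integral_congr fun s hs => ?_
    rw [kInt_smul_dataSpace, mul_assoc]
  · intro h
    rw [← Real.norm_eq_abs, mul_right_comm, ← intervalIntegral.integral_const_mul]
    refine intervalIntegral.norm_integral_le_of_norm_le zero_le_one ?_
      ((intervalIntegrable_weight hα).const_mul _)
    refine Eventually.of_forall fun s hs => ?_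
    have hs' : s ∈ I := Ioc_subset_Icc_self hs
    have hw : 0 ≤ 1 / (1 - s) ^ α := by
      have := Real.rpow_nonneg (show 0 ≤ 1 - s by linarith [hs.2]) α
      positivity
    rw [Real.norm_eq_abs, abs_mul, abs_of_nonneg hw]
    exact mul_le_mul_of_nonneg_right (hC h x hx _ (mul_mem_I ht hs')) hw

/-- The rescaled interval and weight do not depend on the point, so one multiple of the weight
dominates all integrands. -/
lemma continuousOn_integral_weight (hα : α < 1) (hA : IsKernel A) (hB : IsKernel B)
    (h : DataSpace) : ContinuousOn
      (fun q : ℝ × ℝ => ∫ s in (0 : ℝ)..1, kInt A B h q.1 (q.2 * s) * (1 / (1 - s) ^ α)) D := by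
  obtain ⟨C, hC0, hC⟩ := exists_abs_kInt_le hA hB
  have hcont := continuousOn_kInt hA hB (integrable_dataSpace h)
  intro q hq
  refine intervalIntegral.continuousWithinAt_of_dominated_interval
    (bound := fun s => C * ‖h‖ * (1 / (1 - s) ^ α)) ?_ ?_
    ((intervalIntegrable_weight hα).const_mul _) ?_
  · filter_upwards [self_mem_nhdsWithin] with p hp
    exact (intervalIntegrable_kInt_weight hα hA hB hp.1 hp.2
      (integrable_dataSpace h)).aestronglyMeasurable_restrict_uIoc
  · filter_upwards [self_mem_nhdsWithin] with p hp
    refine Eventually.of_forall fun s hs => ?_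
    rw [uIoc_of_le zero_le_one] at hs
    have hs' : s ∈ I := Ioc_subset_Icc_self hs
    have hw : 0 ≤ 1 / (1 - s) ^ α := by
      have := Real.rpow_nonneg (show 0 ≤ 1 - s by linarith [hs.2]) α
      positivity
    rw [Real.norm_eq_abs, abs_mul, abs_of_nonneg hw]
    exact mul_le_mul_of_nonneg_right (hC h _ hp.1 _ (mul_mem_I hp.2 hs')) hw
  · refine Eventually.of_forall fun s hs => ?_
    rw [uIoc_of_le zero_le_one] at hs
    have hs' : s ∈ I := Ioc_subset_Icc_self hs
    have h1 : ContinuousOn (fun q : ℝ × ℝ => kInt A B h q.1 (q.2 * s)) D :=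
      hcont.comp (f := fun q : ℝ × ℝ => (q.1, q.2 * s)) (by fun_prop)
        fun p hp => ⟨hp.1, mul_mem_I hp.2 hs'⟩
    exact (h1 q hq).mul_const _

end

/-- The Caputo derivative in the second variable, in terms of derivative data. -/
def caputoData (α : ℝ) (h : ℝ × ℝ → ℝ) (x t : ℝ) : ℝ :=
  if α = 1 then kInt phi3 dphi2 h x t
  else 1 / Real.Gamma (1 - α) *
    (t ^ (1 - α) * ∫ s in (0 : ℝ)..1, kInt phi3 dphi2 h x (t * s) * (1 / (1 - s) ^ α))

/-! ### The operator `L` on derivative data. -/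

section

variable {α : ℝ} {k₁ k₂ k₃ : ℝ → ℝ → ℝ}

lemma IsSynth.caputo_eq {h : ℝ × ℝ → ℝ} {y : ℝ → ℝ → ℝ} (H : IsSynth h y) (hα : α ≤ 1) :
    ∀ ξ ∈ I, ∀ η ∈ I, caputo α (fun r => y ξ r) η = caputoData α h ξ η := by
  intro ξ hξ η hη
  rcases hα.eq_or_lt with h1 | h1
  · rw [caputo, caputoData, if_pos h1, if_pos h1]
    exact H.dEta_eq ξ hξ η hη
  · rw [caputo_eq_of_lt h1 (H.dEta_eq ξ hξ) hη, caputoData, if_neg h1.ne]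

lemma IsSynth.L_eq {h : ℝ × ℝ → ℝ} {y : ℝ → ℝ → ℝ} (H : IsSynth h y) (hα : α ≤ 1) :
    ∀ ξ ∈ I, ∀ η ∈ I, L α k₁ k₂ k₃ y ξ η = caputoData α h ξ η + k₁ ξ η * kInt ddphi3 phi2 h ξ η
      + k₂ ξ η * kInt phi3 phi2 h ξ η + k₃ ξ η * kInt dphi3 phi2 h ξ η := by
  intro ξ hξ η hη
  rw [L, H.caputo_eq hα ξ hξ η hη, H.dXi_dXi_eq ξ hξ η hη, H.dXi_eq ξ hξ η hη, H.eq ξ hξ η hη,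
    synth]

lemma isSynth_synth (h : DataSpace) : IsSynth h (synth h) := ⟨Lp.memLp h, fun _ _ _ _ => rfl⟩

lemma isRepresentable_L (hα : α ≤ 1) {ξ η : ℝ} (hξ : ξ ∈ I) (hη : η ∈ I) :
    IsRepresentable (fun h => L α k₁ k₂ k₃ (synth h) ξ η) := by
  simp only [fun h : DataSpace => (isSynth_synth h).L_eq (k₁ := k₁) (k₂ := k₂) (k₃ := k₃) hα ξ hξ η hη]
  refine ((IsRepresentable.add ?_ (isRepresentable_kInt isKernel_ddphi3 isKernel_phi2
    hξ hη |>.const_mul _)).add (isRepresentable_kInt isKernel_phi3 isKernel_phi2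
    hξ hη |>.const_mul _)).add (isRepresentable_kInt isKernel_dphi3 isKernel_phi2
    hξ hη |>.const_mul _)
  rcases hα.eq_or_lt with h1 | h1
  · simp only [caputoData, if_pos h1]
    exact isRepresentable_kInt isKernel_phi3 isKernel_dphi2 hξ hη
  · simp only [caputoData, if_neg h1.ne]
    exact ((isRepresentable_integral_weight h1 isKernel_phi3 isKernel_dphi2 hξ hη).const_mul
      _).const_mul _

/-- This permits passing from a dense set of zeros of `L z` to all of `D`. For `α < 1` the exponent
`1 - α` is positive, so `t ^ (1 - α)` is continuous up to `t = 0`. -/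
lemma continuousOn_L (hα : α ≤ 1)
    (hk₁ : ContinuousOn (fun p : ℝ × ℝ => k₁ p.1 p.2) D)
    (hk₂ : ContinuousOn (fun p : ℝ × ℝ => k₂ p.1 p.2) D)
    (hk₃ : ContinuousOn (fun p : ℝ × ℝ => k₃ p.1 p.2) D) (h : DataSpace) :
    ContinuousOn (fun p : ℝ × ℝ => L α k₁ k₂ k₃ (synth h) p.1 p.2) D := by
  have hh := integrable_dataSpace h
  refine ContinuousOn.congr ?_ fun p hp => (isSynth_synth h).L_eq hα p.1 hp.1 p.2 hp.2
  refine (((ContinuousOn.add ?_ (hk₁.mul (continuousOn_kInt isKernel_ddphi3 isKernel_phi2 hh))).add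
    (hk₂.mul (continuousOn_kInt isKernel_phi3 isKernel_phi2 hh)))).add
    (hk₃.mul (continuousOn_kInt isKernel_dphi3 isKernel_phi2 hh))
  rcases hα.eq_or_lt with h1 | h1
  · simp only [caputoData, if_pos h1]
    exact continuousOn_kInt isKernel_phi3 isKernel_dphi2 hh
  · simp only [caputoData, if_neg h1.ne]
    refine continuousOn_const.mul (ContinuousOn.mul ?_
      (continuousOn_integral_weight h1 isKernel_phi3 isKernel_dphi2 h))
    exact continuousOn_snd.rpow_const fun _ _ => Or.inr (by linarith)

/-- The derivative data of `psi` represent the functional `z ↦ L z q`. -/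
lemma exists_isSynth_psi (hα : α ≤ 1) {q : ℝ × ℝ} (hq : q ∈ D) :
    ∃ k : DataSpace, IsSynth k (psi α k₁ k₂ k₃ q) ∧
      ∀ h : DataSpace, L α k₁ k₂ k₃ (synth h) q.1 q.2 = inner ℝ k h := by
  obtain ⟨k, hk⟩ := isRepresentable_L (k₁ := k₁) (k₂ := k₂) (k₃ := k₃) hα hq.1 hq.2
  replace hk : ∀ h : DataSpace, L α k₁ k₂ k₃ (synth h) q.1 q.2 = inner ℝ k h := hk
  refine ⟨k, ⟨Lp.memLp k, fun ξ hξ η hη => ?_⟩, hk⟩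
  have H := isSynth_K' hξ hη
  set κ : DataSpace := H.memLp.toLp _ with hκ
  have hae : κ =ᵐ[atomSq] kernelData ξ η := H.memLp.coeFn_toLp
  have H' : IsSynth κ (fun x t => K x t ξ η) := ⟨Lp.memLp κ, fun x hx t ht => by
    rw [H.eq x hx t ht, synth, synth, kInt_congr_ae hae]⟩
  -- Here `psi` at `(ξ,η)` is the functional `L` at `q` applied to the evaluation representer `κ`,
  -- that is `⟨k, κ⟩`, which is also the value of `synth k` at `(ξ,η)`.
  rw [psi, H'.L_eq hα q.1 hq.1 q.2 hq.2, ← (isSynth_synth κ).L_eq hα q.1 hq.1 q.2 hq.2, hk,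
    inner_dataSpace, synth_eq_integral]
  refine integral_congr_ae ?_
  filter_upwards [hae] with p hp
  rw [hp, mul_comm]

end

/-! ### Orthogonal expansions and transfer to the function space. -/

/-- Expansion with respect to an orthogonal family of unit or zero vectors. -/
lemma tendsto_sum_inner_smul {E : Type*} [NormedAddCommGroup E] [InnerProductSpace ℝ E]
    {e : ℕ → E} (horth : ∀ i j, i ≠ j → inner ℝ (e i) (e j) = 0)
    (hnormal : ∀ i, ‖e i‖ = 1 ∨ e i = 0) {Y : E}
    (hY : Y ∈ closure (Submodule.span ℝ (range e) : Set E)) :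
    Tendsto (fun n => ∑ i ∈ Finset.range n, inner ℝ Y (e i) • e i) atTop (𝓝 Y) := by
  set S : ℕ → E := fun n => ∑ i ∈ Finset.range n, inner ℝ Y (e i) • e i with hS
  have hbasis : ∀ j n, j < n → inner ℝ (Y - S n) (e j) = 0 := by
    intro j n hj
    rw [inner_sub_left, hS, sum_inner, Finset.sum_eq_single j]
    · rw [real_inner_smul_left]
      rcases hnormal j with h | h
      · rw [real_inner_self_eq_norm_sq, h]; ring
      · simp [h]
    · intro i _ hij
      rw [real_inner_smul_left, horth i j hij, mul_zero]
    · exact fun h => absurd (Finset.mem_range.2 hj) h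
  have hspan : ∀ z ∈ Submodule.span ℝ (range e), ∀ᶠ n in atTop, inner ℝ (Y - S n) z = 0 := by
    intro z hz
    induction hz using Submodule.span_induction with
    | mem z hz =>
      obtain ⟨j, rfl⟩ := hz
      exact (eventually_gt_atTop j).mono fun n hn => hbasis j n hn
    | zero => exact Eventually.of_forall fun n => inner_zero_right _
    | add x y _ _ hx hy =>
      filter_upwards [hx, hy] with n h1 h2
      rw [inner_add_right, h1, h2, add_zero]
    | smul a x _ hx =>
      filter_upwards [hx] with n h1
      rw [real_inner_smul_right, h1, mul_zero]
  have hself : ∀ n, inner ℝ (Y - S n) (S n) = 0 := by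
    intro n
    conv_lhs => rw [show S n = ∑ i ∈ Finset.range n, inner ℝ Y (e i) • e i from rfl, inner_sum]
    refine Finset.sum_eq_zero fun i hi => ?_
    rw [real_inner_smul_right]
    have := hbasis i n (Finset.mem_range.1 hi)
    rw [hS] at this
    rw [this, mul_zero]
  rw [Metric.tendsto_nhds]
  intro ε hε
  obtain ⟨z, hz, hdist⟩ := Metric.mem_closure_iff.1 hY ε hε
  filter_upwards [hspan z hz] with n hn
  rw [dist_comm, dist_eq_norm]
  rw [dist_eq_norm] at hdist
  refine lt_of_le_of_lt ?_ hdist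
  -- The residual is orthogonal to `S n` and, for large `n`, to the approximant `z` from the span;
  -- hence `S n` approximates `Y` at least as well as `z` does.
  have h1 : ‖Y - S n‖ * ‖Y - S n‖ ≤ ‖Y - S n‖ * ‖Y - z‖ := by
    have h2 : inner ℝ (Y - S n) (Y - S n) = inner ℝ (Y - S n) (Y - z) := by
      conv_lhs => rw [inner_sub_right, hself n]
      rw [inner_sub_right, hn]
    rw [← real_inner_self_eq_norm_mul_norm, h2]
    exact real_inner_le_norm _ _
  rcases (norm_nonneg (Y - S n)).eq_or_lt with h0 | h0
  · rw [← h0]; exact norm_nonneg _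
  · exact le_of_mul_le_mul_left h1 h0

lemma IsSynth.toLp {h : ℝ × ℝ → ℝ} {y : ℝ → ℝ → ℝ} (H : IsSynth h y) :
    IsSynth (H.memLp.toLp h : DataSpace) y :=
  ⟨Lp.memLp _, fun ξ hξ η hη => by
    rw [H.eq ξ hξ η hη, synth, synth, kInt_congr_ae H.memLp.coeFn_toLp]⟩

lemma MemW32.exists_dataSpace {y : ℝ → ℝ → ℝ} (hy : MemW32 y) : ∃ Y : DataSpace, IsSynth Y y := by
  obtain ⟨h, H⟩ := hy.exists_isSynth
  exact ⟨_, H.toLp⟩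

lemma IsSynth.inner32_eq_inner {h k : DataSpace} {y v : ℝ → ℝ → ℝ} (H : IsSynth h y)
    (G : IsSynth k v) : inner32 y v = inner ℝ h k := by
  rw [H.inner32_eq G, inner_dataSpace]

lemma IsSynth.norm32_eq {h : DataSpace} {y : ℝ → ℝ → ℝ} (H : IsSynth h y) : norm32 y = ‖h‖ := by
  rw [norm32, H.inner32_eq_inner H, norm_eq_sqrt_real_inner]

/-- By isometry `‖h - k‖²` expands into four terms, all equal to `inner32 y y` up to sign. -/
lemma IsSynth.unique {h k : DataSpace} {y : ℝ → ℝ → ℝ} (H : IsSynth h y) (G : IsSynth k y) :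
    h = k := by
  rw [← sub_eq_zero, ← inner_self_eq_zero (𝕜 := ℝ), inner_sub_left, inner_sub_right,
    inner_sub_right, ← H.inner32_eq_inner H, ← H.inner32_eq_inner G, ← G.inner32_eq_inner H,
    ← G.inner32_eq_inner G]
  ring

/-- Point values of `synth` are inner products with a fixed vector, so linearity needs no almost
everywhere bookkeeping. -/
lemma isSynth_sum {s : Finset ℕ} {c : ℕ → ℝ} {k : ℕ → DataSpace} {u : ℕ → ℝ → ℝ → ℝ}
    (H : ∀ j, IsSynth (k j) (u j)) :
    IsSynth (∑ j ∈ s, c j • k j : DataSpace) (fun ξ η => ∑ j ∈ s, c j * u j ξ η) := by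
  refine ⟨Lp.memLp _, fun ξ hξ η hη => ?_⟩
  obtain ⟨κ, hκ⟩ := isRepresentable_kInt isKernel_phi3 isKernel_phi2 hξ hη
  replace hκ : ∀ h : DataSpace, synth h ξ η = inner ℝ κ h := hκ
  rw [hκ, inner_sum]
  refine Finset.sum_congr rfl fun j _ => ?_
  rw [(H j).eq ξ hξ η hη, hκ, real_inner_smul_right]

lemma IsSynth.sub {h k : DataSpace} {y v : ℝ → ℝ → ℝ} (H : IsSynth h y) (G : IsSynth k v) :
    IsSynth (h - k : DataSpace) (fun ξ η => y ξ η - v ξ η) := by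
  refine ⟨Lp.memLp _, fun ξ hξ η hη => ?_⟩
  obtain ⟨κ, hκ⟩ := isRepresentable_kInt isKernel_phi3 isKernel_phi2 hξ hη
  replace hκ : ∀ h : DataSpace, synth h ξ η = inner ℝ κ h := hκ
  rw [hκ, inner_sub_right, H.eq ξ hξ η hη, G.eq ξ hξ η hη, hκ, hκ]

lemma isSynth_zero {y : ℝ → ℝ → ℝ} (hy : ∀ ξ ∈ I, ∀ η ∈ I, y ξ η = 0) :
    IsSynth (0 : DataSpace) y := by
  refine ⟨Lp.memLp _, fun ξ hξ η hη => ?_⟩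
  obtain ⟨κ, hκ⟩ := isRepresentable_kInt isKernel_phi3 isKernel_phi2 hξ hη
  replace hκ : ∀ h : DataSpace, synth h ξ η = inner ℝ κ h := hκ
  rw [hκ, inner_zero_right, hy ξ hξ η hη]

/-- Vectors orthogonal to all nondegenerate triangular combinations of `k` are orthogonal
to `k`. -/
lemma inner_eq_zero_of_triangular {E : Type*} [NormedAddCommGroup E] [InnerProductSpace ℝ E]
    {k : ℕ → E} {β : ℕ → ℕ → ℝ} (hβ : ∀ i, 0 < β i i) {z : E}
    (hz : ∀ i, inner ℝ (∑ j ∈ Finset.range (i + 1), β i j • k j) z = 0) (i : ℕ) :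
    inner ℝ (k i) z = 0 := by
  induction i using Nat.strong_induction_on with
  | _ i ih =>
    have h := hz i
    rw [sum_inner, Finset.sum_range_succ, Finset.sum_eq_zero, zero_add, real_inner_smul_left] at h
    · exact (mul_eq_zero.1 h).resolve_left (hβ i).ne'
    · intro j hj
      rw [real_inner_smul_left, ih j (Finset.mem_range.1 hj), mul_zero]

end Burgers

end

/-! ### The expansion theorem. -/

open Burgers

theorem theorem3p3 (α : ℝ) (hα0 : 0 < α) (hα1 : α ≤ 1)
    (k₁ k₂ k₃ k₄ f : ℝ → ℝ → ℝ)
    (hk₁ : ContinuousOn (fun p : ℝ × ℝ => k₁ p.1 p.2) Burgers.D)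
    (hk₂ : ContinuousOn (fun p : ℝ × ℝ => k₂ p.1 p.2) Burgers.D)
    (hk₃ : ContinuousOn (fun p : ℝ × ℝ => k₃ p.1 p.2) Burgers.D)
    (hk₄ : ContinuousOn (fun p : ℝ × ℝ => k₄ p.1 p.2) Burgers.D)
    (hf : ContinuousOn (fun p : ℝ × ℝ => f p.1 p.2) Burgers.D)
    -- `L` is injective on the space (existence of the inverse of `L`)
    (hL : ∀ z : ℝ → ℝ → ℝ, Burgers.MemW32 z →
      (∀ ξ ∈ Burgers.I, ∀ η ∈ Burgers.I, Burgers.L α k₁ k₂ k₃ z ξ η = 0) →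
      ∀ ξ ∈ Burgers.I, ∀ η ∈ Burgers.I, z ξ η = 0)
    -- a sequence of points of `D`, dense in `D`
    (q : ℕ → ℝ × ℝ) (hqD : ∀ i, q i ∈ Burgers.D) (hq : Burgers.D ⊆ closure (Set.range q))
    (ψbar : ℕ → ℝ → ℝ → ℝ) (β : ℕ → ℕ → ℝ)
    (hψ : Burgers.IsGramSchmidt (fun i => Burgers.psi α k₁ k₂ k₃ (q i)) ψbar β)
    (y : ℝ → ℝ → ℝ) (hy : Burgers.IsSolution α k₁ k₂ k₃ k₄ f y) :
    Burgers.IsReproducingKernel Burgers.K ∧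
    (∀ i, Burgers.MemW32 (ψbar i)) ∧
    Tendsto (fun n : ℕ => Burgers.norm32 (fun ξ η => y ξ η -
        ∑ i ∈ Finset.range n, Burgers.coeff f k₄ q β y i * ψbar i ξ η)) atTop (𝓝 0) ∧
    TendstoUniformlyOn (fun (n : ℕ) (p : ℝ × ℝ) =>
        ∑ i ∈ Finset.range n, Burgers.coeff f k₄ q β y i * ψbar i p.1 p.2)
      (fun p => y p.1 p.2) atTop Burgers.D := by
  choose k hk hkL using fun i => exists_isSynth_psi (k₁ := k₁) (k₂ := k₂) (k₃ := k₃) hα1 (hqD i)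
  set e : ℕ → DataSpace := fun i => ∑ j ∈ Finset.range (i + 1), β i j • k j with he
  have heS : ∀ i, IsSynth (e i) (ψbar i) := fun i => by
    have h := isSynth_sum (s := Finset.range (i + 1)) (c := β i) hk
    exact ⟨h.memLp, fun ξ hξ η hη => by rw [hψ.comb i ξ η]; exact h.eq ξ hξ η hη⟩
  have horth : ∀ i j, i ≠ j → inner ℝ (e i) (e j) = 0 := fun i j hij => by
    rw [← (heS i).inner32_eq_inner (heS j), hψ.orth i j hij]
  have hnormal : ∀ i, ‖e i‖ = 1 ∨ e i = 0 := fun i =>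
    (hψ.normal i).imp (fun h => by rw [← (heS i).norm32_eq, h])
      (fun h => (heS i).unique (isSynth_zero h))
  obtain ⟨hyW, hyL⟩ := hy
  obtain ⟨Y, hY⟩ := hyW.exists_dataSpace
  -- Pairing with `k j` evaluates `L y` at `q j`, and the equation replaces that value by `F`; `y`
  -- and `synth Y` have the same `L` on `D`.
  have hcoeff : ∀ i, inner ℝ Y (e i) = coeff f k₄ q β y i := by
    intro i
    rw [he, inner_sum, coeff]
    refine Finset.sum_congr rfl fun j _ => ?_
    rw [real_inner_smul_right, real_inner_comm, ← hkL j Y, ← hyL _ (hqD j).1 _ (hqD j).2,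
      hY.L_eq hα1 _ (hqD j).1 _ (hqD j).2, (isSynth_synth Y).L_eq hα1 _ (hqD j).1 _ (hqD j).2]
  have hcomplete : ∀ z : DataSpace, (∀ i, inner ℝ (e i) z = 0) → z = 0 := by
    intro z hz
    have hLq : ∀ i, L α k₁ k₂ k₃ (synth z) (q i).1 (q i).2 = 0 := fun i => by
      rw [hkL i z]
      exact inner_eq_zero_of_triangular hψ.pos hz i
    have hcont := continuousOn_L hα1 hk₁ hk₂ hk₃ z
    have hL0 : ∀ ξ ∈ I, ∀ η ∈ I, L α k₁ k₂ k₃ (synth z) ξ η = 0 := by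
      intro ξ hξ η hη
      have hp : (ξ, η) ∈ D := ⟨hξ, hη⟩
      -- By continuity on `D`, the value at a limit of the points `q i` lies in the closure of
      -- `{0}`.
      have h1 := ((hcont _ hp).mono (range_subset_iff.2 hqD)).mem_closure (hq hp)
        (t := {0}) (by rintro _ ⟨i, rfl⟩; exact hLq i)
      simpa using h1
    exact (isSynth_synth z).unique (isSynth_zero (hL _ (isSynth_synth z).memW32 hL0))
  -- Totality: a vector orthogonal to the span of the `e i` is zero by `hcomplete`.
  have hdense : Y ∈ closure (Submodule.span ℝ (range e) : Set DataSpace) := by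
    have h1 : (Submodule.span ℝ (range e)).topologicalClosure = ⊤ := by
      rw [Submodule.topologicalClosure_eq_top_iff, Submodule.eq_bot_iff]
      intro z hz
      refine hcomplete z fun i => ?_
      exact (Submodule.mem_orthogonal _ _).1 hz _ (Submodule.subset_span ⟨i, rfl⟩)
    rw [← Submodule.topologicalClosure_coe, h1]
    trivial
  have hlim := tendsto_sum_inner_smul horth hnormal hdense
  simp only [hcoeff] at hlim
  have hrem : Tendsto (fun n => ‖Y - ∑ i ∈ Finset.range n, coeff f k₄ q β y i • e i‖) atTop
      (𝓝 0) := by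
    simp only [norm_sub_rev Y]
    exact tendsto_iff_norm_sub_tendsto_zero.1 hlim
  have hremS : ∀ n, IsSynth (Y - ∑ i ∈ Finset.range n, coeff f k₄ q β y i • e i : DataSpace)
      (fun ξ η => y ξ η - ∑ i ∈ Finset.range n, coeff f k₄ q β y i * ψbar i ξ η) := fun n =>
    hY.sub (isSynth_sum heS)
  refine ⟨isReproducingKernel_K, fun i => (heS i).memW32, ?_, ?_⟩
  · simp only [fun n => (hremS n).norm32_eq]
    exact hrem
  -- The remainder at any point of `D` is at most `C` times its norm, with `C` independent of the
  -- point.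
  · obtain ⟨C, -, hC⟩ := exists_abs_kInt_le isKernel_phi3 isKernel_phi2
    rw [Metric.tendstoUniformlyOn_iff]
    intro ε hε
    have h0 := (hrem.const_mul C)
    rw [mul_zero] at h0
    filter_upwards [h0.eventually_lt_const hε] with n hn p hp
    rw [Real.dist_eq]
    refine lt_of_le_of_lt ?_ hn
    have h1 := (hremS n).eq p.1 hp.1 p.2 hp.2
    rw [h1]
    exact hC _ p.1 hp.1 p.2 hp.2
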